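/- Logarithms are to base $2$. Let $d\ge 1$, let $\Lambda$ be a finite nonempty set, let $r_{i,j}\in(-1,1)\setminus\{0\}$ for $i\in\Lambda$, $1\le j\le d$, and let $p=(p_i)_{i\in\Lambda}$ be a probability vector. Put $\chi_j:=-\sum_{i\in\Lambda}p_i\log|r_{i,j}|$ (the Lyapunov exponents of the diagonal system with linear parts $\mathrm{diag}(r_{i,1},\dots,r_{i,d})$), and assume $\chi_1<\chi_2<\dots<\chi_d$. For $n\in\mathbb Z$ let $\mathcal E_n$ be the partition of $\mathbb R^d$ into the boxes $D_1\times\dots\times D_d$, where each $D_j$ is a dyadic interval $[a2^{-\lfloor \chi_jn\rfloor},(a+1)2^{-\lfloor\chi_jn\rfloor})$, $a\in\mathbb Z$. For $J\subset[d]:=\{1,\dots,d\}$ let $\pi_J$ be the orthogonal projection of $\mathbb R^d$ onto $\mathrm{span}\{e_j: j\in J\}$. Write $H(\theta,\mathcal D)=-\sum_{D\in\mathcal D}\theta(D)\log\theta(D)$ and $H(\theta,\mathcal D\mid\mathcal E)=\sum_{E\in\mathcal E,\,\theta(E)>0}\theta(E)H(\theta_E,\mathcal D)$ with $\theta_E=\theta(E)^{-1}\theta|_E$;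 write $\mathcal D\vee\mathcal E=\{D\cap E: D\in\mathcal D,E\in\mathcal E\}$, $\pi_J^{-1}\mathcal D=\{\pi_J^{-1}(D): D\in\mathcal D\}$, and $\theta^{*k}$ for the $k$-fold convolution of $\theta$ with itself. Then there exists a function $f:[1,\infty)\to[1,\infty)$, depending only on the data $(d,\Lambda,r,p)$, such that, with $R_1\ll R_2$ meaning $R_2\ge f(R_1)$, the following holds. For every $0<\epsilon<1$ there exists $\delta>0$ such that: let $m_1,\dots,m_d,k_1,\dots,k_d,n$ be positive integers with - $\epsilon^{-1}\ll m_d$ and $k_1\ll n$; - $m_j\ll k_j$ for $1\le j\le d$; - $k_{j+1}\ll m_j$ for $1\le j<d$, and let $\theta$ be a compactly supported Borel probability measure on $\mathbb R^d$ with $\mathrm{diam}(\mathrm{supp}\,\theta)\le\epsilon^{-1}$ and $\frac1nH(\theta,\mathcal E_n)>\epsilon$. For $1\le j\le d$ let $Q_j$ be the set of all integers $1\le q\le n$ such that $$\frac1{m_j}H\left(\theta^{*k_j},\mathcal E_{q+m_j}\,\middle|\,\mathcal E_q\vee\pi_{[d]\setminus\{j\}}^{-1}\mathcal E_{q+m_j}\right)>\chi_j-\epsilon.$$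 Then there exists $1\le j\le d$ such that $\frac1n|Q_j|>\delta$. -/

import Mathlib

open MeasureTheory ProbabilityTheory

namespace NonConformal

/-- The exponent `χ_j = -∑ i, p_i log₂ |r_{i,j}|` of a diagonal system with linear parts
`diag (r i)` and probability vector `p`. -/
noncomputable def lyapunovExponent {Λ : Type*} [Fintype Λ] {d : ℕ}
    (p : Λ → ℝ) (r : Λ → Fin d → ℝ) (j : Fin d) : ℝ :=
  -∑ i, p i * Real.logb 2 |r i j|

/-- The level-`n` dyadic partition of the real line. -/
def dyadicPartition (n : ℤ) : Set (Set ℝ) :=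
  {D | ∃ k : ℤ, D = Set.Ico ((k : ℝ) / 2 ^ n) (((k : ℝ) + 1) / 2 ^ n)}

/-- The level-`n` non-conformal partition of `ℝ^d` associated to `χ`: its cells are the boxes
`D_1 × ... × D_d` with `D_j` a dyadic interval of level `⌊χ_j n⌋`. -/
def partitionE {d : ℕ} (χ : Fin d → ℝ) (n : ℤ) : Set (Set (EuclideanSpace ℝ (Fin d))) :=
  {E | ∃ D : Fin d → Set ℝ, (∀ j, D j ∈ dyadicPartition ⌊χ j * (n : ℝ)⌋) ∧
    E = {x | ∀ j, x j ∈ D j}}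

/-- The orthogonal projection of `ℝ^d` onto the span of the `e_j` with `j ∈ J`. -/
def coordProj {d : ℕ} (J : Finset (Fin d)) (x : EuclideanSpace ℝ (Fin d)) :
    EuclideanSpace ℝ (Fin d) :=
  WithLp.toLp 2 (fun j => if j ∈ J then x j else 0)

/-- The preimage `f⁻¹ 𝒞 = {f⁻¹(C) : C ∈ 𝒞}` of a partition. -/
def preimagePartition {X Y : Type*} (f : X → Y) (𝒞 : Set (Set Y)) : Set (Set X) :=
  {D | ∃ C ∈ 𝒞, D = f ⁻¹' C}

/-- The join `𝒟 ∨ ℰ = {D ∩ E : D ∈ 𝒟, E ∈ ℰ}` of two partitions. -/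
def joinPartition {X : Type*} (𝒟 ℰ : Set (Set X)) : Set (Set X) :=
  {F | ∃ D ∈ 𝒟, ∃ E ∈ ℰ, F = D ∩ E}

/-- The entropy `H(θ, 𝒟)` in base `2` of a probability measure with respect to a countable
partition, for measures of finite entropy. A compactly supported measure charges only finitely
many cells of the partitions used here, so that the sum is then a finite one. -/
noncomputable def entropy {X : Type*} [MeasurableSpace X] (θ : Measure X)
    (𝒟 : Set (Set X)) : ℝ :=
  -∑' D : 𝒟, θ.real D.1 * Real.logb 2 (θ.real D.1)

/-- The conditional entropy `H(θ, 𝒟 | ℰ) = ∑_{E ∈ ℰ} θ(E) H(θ_E, 𝒟)`, where `θ_E` is `θ`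
conditioned on `E`; null cells contribute `0`. -/
noncomputable def condEntropy {X : Type*} [MeasurableSpace X] (θ : Measure X)
    (𝒟 ℰ : Set (Set X)) : ℝ :=
  ∑' E : ℰ, θ.real E.1 * entropy (ProbabilityTheory.cond θ E.1) 𝒟

/-- The `k`-fold convolution of `θ` with itself: the law of `x_1 + ... + x_k` under `θ^{×k}`. -/
noncomputable def selfConv {d : ℕ} (θ : Measure (EuclideanSpace ℝ (Fin d))) (k : ℕ) :
    Measure (EuclideanSpace ℝ (Fin d)) :=
  (Measure.pi (fun _ : Fin k => θ)).map (fun x => ∑ s, x s)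

/-- The conditional entropy
`H(θ^{*k}, ℰ_{q+m} | ℰ_q ∨ π_{[d]∖{j}}⁻¹ ℰ_{q+m})` of the self-convolution along thin tubes
in direction `e_j`. -/
noncomputable def tubeEntropy {d : ℕ} (χ : Fin d → ℝ) (θ : Measure (EuclideanSpace ℝ (Fin d)))
    (j : Fin d) (m k q : ℕ) : ℝ :=
  condEntropy (selfConv θ k) (partitionE χ ((q : ℤ) + (m : ℤ)))
    (joinPartition (partitionE χ (q : ℤ))
      (preimagePartition (coordProj ({j}ᶜ : Finset (Fin d)))
        (partitionE χ ((q : ℤ) + (m : ℤ)))))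

end NonConformal

open NonConformal

namespace NonConformal

/-! The argument finds a direction in which many components of `θ` have non-negligible variance, and
then shows that convolution turns variance into almost full entropy along tubes.

Cut `ℝ^d` into boxes with sides about `2^(-χ_i (q + L_i))`, where `L_i` is a large multiple of
`k_{i+1}` (and `0` in the last direction). The entropy of `θ` on these boxes grows with `q` up to at
least a multiple of `ε n`, so its increments over windows of length `M ~ 1/ε` are large on average.
An increment is at most a constant plus a multiple of the sum over `j` of the mean rescaled
variances of the components (`exists_variance_of_entropy_increment`). The constant is beaten by `M
ε`, so some direction `j` has mean variance at least `c = c(ε)` at a proportion of the scales `q`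
(`exists_many_hasVariance`).

Fix such `q` and `j`. The measure `θ^{*k}` is a mixture, over words of length `k`, of laws of sums
of `k` independent components. Conditional entropy is concave, so it suffices to average over words
(`tube_entropy_lower_bound`). In direction `j`, Esseen's inequality bounds the mass of short
intervals; averaged over words, the product of the moduli of the characteristic functions is a
`k`-th power, and only the mean variance matters. The sums thus spread over width about `√k 2^(-χ_j
(q + L_j))`. Choose `s` with `4^(χ_j s) ~ k`: this width is the scale `a = q + L_j - s`, and the
entropy of coordinate `j` at level `a + m` is at least `χ_j m log 2 - O(1)`, with a constant
depending on `c`.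

The tube partition must carry only bounded entropy, that is, the sums must have bounded variance at
its levels. For coordinate `j` at level `a` this is the choice of `s`. For `i < j` it holds because
`L_i` is at least a multiple of `k_j`, so the boxes are very thin in direction `i`. For `i > j` it
holds because `χ_i > χ_j`: moving up by `s` scales gains `χ_i s` against the loss `χ_j s` from
convolution. The same offsets serve every `j`, which is needed because `j` is found only afterwards.
Replacing `q` by `a` loses few scales, since `n` dominates `k_1`. -/

/-- Marginal of a weight `p` on a finite set under a map `f`. -/
noncomputable def marginal {α β : Type*} (T : Finset α) (p : α → ℝ) (f : α → β) (b : β) : ℝ :=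
  open Classical in ∑ a ∈ T with f a = b, p a

/-- Entropy (natural logarithm) of a map on a finite weighted set. -/
noncomputable def finEntropy {α β : Type*} (T : Finset α) (p : α → ℝ) (f : α → β) : ℝ :=
  ∑ a ∈ T, p a * (-Real.log (marginal T p f (f a)))

/-! ### Entropy of maps on a finite weighted set -/

section finite

variable {α β γ : Type*} {T : Finset α} {p : α → ℝ}

lemma marginal_nonneg (hp : ∀ a, 0 ≤ p a) (f : α → β) (b : β) : 0 ≤ marginal T p f b :=
  Finset.sum_nonneg fun a _ => hp a

lemma le_marginal (hp : ∀ a, 0 ≤ p a) (f : α → β) {a : α} (ha : a ∈ T) :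
    p a ≤ marginal T p f (f a) := by
  classical
  exact Finset.single_le_sum (f := p) (fun a _ => hp a) (by simp [ha])

lemma marginal_id {a : α} (ha : a ∈ T) : marginal T p id a = p a := by
  classical
  simp [marginal, Finset.sum_filter, ha]

lemma sum_mul_comp (f : α → β) (φ : β → ℝ) [DecidableEq β] :
    ∑ a ∈ T, p a * φ (f a) = ∑ b ∈ T.image f, marginal T p f b * φ b := by
  classical
  rw [← Finset.sum_fiberwise_of_maps_to (t := T.image f) (g := f)
    (fun a ha => Finset.mem_image_of_mem f ha)]
  refine Finset.sum_congr rfl fun b _ => ?_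
  rw [marginal, Finset.sum_mul]
  refine Finset.sum_congr (by ext; simp) fun a ha => ?_
  simp only [Finset.mem_filter] at ha
  rw [ha.2]

lemma sum_marginal (f : α → β) [DecidableEq β] :
    ∑ b ∈ T.image f, marginal T p f b = ∑ a ∈ T, p a := by
  simpa using (sum_mul_comp (T := T) (p := p) f (fun _ => 1)).symm

lemma finEntropy_eq_sum_negMulLog (f : α → β) [DecidableEq β] :
    finEntropy T p f = ∑ b ∈ T.image f, Real.negMulLog (marginal T p f b) := by
  rw [finEntropy, sum_mul_comp f (fun b => -Real.log (marginal T p f b))]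
  exact Finset.sum_congr rfl fun b _ => by rw [Real.negMulLog]; ring

lemma finEntropy_mono (hp : ∀ a, 0 ≤ p a) {f : α → β} {g : α → γ}
    (h : ∀ a ∈ T, ∀ a' ∈ T, f a = f a' → g a = g a') :
    finEntropy T p g ≤ finEntropy T p f := by
  classical
  refine Finset.sum_le_sum fun a ha => ?_
  rcases (hp a).eq_or_lt with h0 | h0
  · simp [← h0]
  refine mul_le_mul_of_nonneg_left (neg_le_neg (Real.log_le_log
    (h0.trans_le (le_marginal hp f ha)) ?_)) (hp a)
  refine Finset.sum_le_sum_of_subset_of_nonneg (fun a' ha' => ?_) fun a _ _ => hp a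
  simp only [Finset.mem_filter] at ha' ⊢
  exact ⟨ha'.1, h a' ha'.1 a ha ha'.2⟩

/-- Gibbs' inequality. -/
lemma finEntropy_le_of_weight (hp : ∀ a, 0 ≤ p a) (f : α → β) [DecidableEq β] (g : β → ℝ)
    (hg : ∀ b, 0 ≤ g b) (hpos : ∀ a ∈ T, 0 < p a → 0 < g (f a)) :
    finEntropy T p f ≤
      ∑ a ∈ T, p a * (-Real.log (g (f a))) + ∑ b ∈ T.image f, g b - ∑ a ∈ T, p a := by
  rw [finEntropy, sum_mul_comp f (fun b => -Real.log (marginal T p f b)),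
    sum_mul_comp f (fun b => -Real.log (g b)), ← sum_marginal f, ← Finset.sum_add_distrib,
    ← Finset.sum_sub_distrib]
  refine Finset.sum_le_sum fun b hb => ?_
  obtain ⟨a, ha, rfl⟩ := Finset.mem_image.1 hb
  rcases (marginal_nonneg (T := T) hp f (f a)).eq_or_lt with h0 | h0
  · simp [← h0, hg]
  have hgp : 0 < g (f a) := by
    classical
    obtain ⟨a', ha', h1⟩ := Finset.exists_lt_of_sum_lt (f := fun _ => (0 : ℝ)) (g := p)
      (s := T.filter (f · = f a)) (by
        rw [Finset.sum_const_zero]; convert h0 using 1; unfold marginal; congr)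
    rw [Finset.mem_filter] at ha'
    rw [← ha'.2]
    exact hpos a' ha'.1 h1
  have := Real.log_le_sub_one_of_pos (div_pos hgp h0)
  rw [Real.log_div hgp.ne' h0.ne'] at this
  have h2 := mul_le_mul_of_nonneg_left this h0.le
  rw [mul_sub, mul_sub, mul_div_cancel₀ _ h0.ne'] at h2
  linarith

/-- Gibbs' inequality for the joint map, tested against the product of the marginals, whose total
mass on the image is at most one. -/
lemma finEntropy_le_sum {ι : Type*} [Fintype ι] {δ : ι → Type*} (hp : ∀ a, 0 ≤ p a)
    (hp1 : ∑ a ∈ T, p a = 1) (w : ∀ i, α → δ i) {g : α → γ}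
    (h : ∀ a ∈ T, ∀ a' ∈ T, (∀ i, w i a = w i a') → g a = g a') :
    finEntropy T p g ≤ ∑ i, finEntropy T p (w i) := by
  classical
  let W : α → ∀ i, δ i := fun a i => w i a
  have h1 : finEntropy T p g ≤ finEntropy T p W :=
    finEntropy_mono hp fun a ha a' ha' hh => h a ha a' ha' fun i => congrFun hh i
  have h2 := finEntropy_le_of_weight (T := T) hp W (fun b => ∏ i, marginal T p (w i) (b i))
    (fun b => Finset.prod_nonneg fun i _ => marginal_nonneg hp _ _)
    (fun a ha h0 => Finset.prod_pos fun i _ => h0.trans_le (le_marginal hp (w i) ha))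
  have h3 : ∑ b ∈ T.image W, ∏ i, marginal T p (w i) (b i) ≤ 1 := by
    calc _ ≤ ∑ b ∈ Fintype.piFinset fun i => T.image (w i), ∏ i, marginal T p (w i) (b i) := by
          refine Finset.sum_le_sum_of_subset_of_nonneg (fun b hb => ?_)
            fun b _ _ => Finset.prod_nonneg fun i _ => marginal_nonneg hp _ _
          obtain ⟨a, ha, rfl⟩ := Finset.mem_image.1 hb
          exact Fintype.mem_piFinset.2 fun i => Finset.mem_image_of_mem _ ha
      _ = ∏ i, ∑ b ∈ T.image (w i), marginal T p (w i) b := (Finset.prod_univ_sum ..).symm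
      _ = 1 := by simp [sum_marginal, hp1]
  have h4 : ∑ a ∈ T, p a * (-Real.log (∏ i, marginal T p (w i) (W a i)))
      = ∑ i, finEntropy T p (w i) := by
    simp only [finEntropy]
    rw [Finset.sum_comm]
    refine Finset.sum_congr rfl fun a ha => ?_
    rcases (hp a).eq_or_lt with h0 | h0
    · simp [← h0]
    rw [Real.log_prod (fun i _ => (h0.trans_le (le_marginal hp (w i) ha)).ne'),
      ← Finset.sum_neg_distrib, Finset.mul_sum]
  linarith

/-- Concavity of conditional entropy. -/
lemma finEntropy_sub_concave {κ : Type*} [Fintype κ] (l : κ → ℝ) (P : κ → α → ℝ)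
    (hl : ∀ c, 0 ≤ l c) (hP : ∀ c a, 0 ≤ P c a) (hpP : ∀ a, p a = ∑ c, l c * P c a)
    (g : α → γ) :
    ∑ c, l c * (finEntropy T (P c) id - finEntropy T (P c) g) ≤
      finEntropy T p id - finEntropy T p g := by
  classical
  have hp : ∀ a, 0 ≤ p a := fun a => by
    rw [hpP]; exact Finset.sum_nonneg fun c _ => mul_nonneg (hl c) (hP c a)
  have hmarg : ∀ b, marginal T p g b = ∑ c, l c * marginal T (P c) g b := fun b => by
    simp only [marginal, hpP, Finset.mul_sum]
    exact Finset.sum_comm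
  -- The log-sum inequality term by term, from `log x ≤ x - 1`. The corrections on the right are
  -- chosen so that their sum over `c` is at most zero.
  have key : ∀ c, ∀ a ∈ T, l c * (P c a * (-Real.log (marginal T (P c) id a))
      - P c a * (-Real.log (marginal T (P c) g (g a)))) ≤
      l c * P c a * (-Real.log (p a) + Real.log (marginal T p g (g a)))
      + (p a / marginal T p g (g a) * (l c * marginal T (P c) g (g a)) - l c * P c a) := by
    intro c a ha
    rcases (mul_nonneg (hl c) (hP c a)).eq_or_lt with h0 | h0
    · have : l c * (P c a * (-Real.log (marginal T (P c) id a))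
          - P c a * (-Real.log (marginal T (P c) g (g a)))) = (l c * P c a) *
            (-Real.log (marginal T (P c) id a) + Real.log (marginal T (P c) g (g a))) := by ring
      rw [this, ← h0]
      have := mul_nonneg (div_nonneg (hp a) (marginal_nonneg (T := T) hp g (g a)))
        (mul_nonneg (hl c) (marginal_nonneg (T := T) (hP c) g (g a)))
      simpa using this
    have hl0 : 0 < l c := (hl c).lt_of_ne fun h => by simp [← h] at h0
    have hP0 : 0 < P c a := (hP c a).lt_of_ne fun h => by simp [← h] at h0
    have hm : 0 < marginal T (P c) g (g a) := hP0.trans_le (le_marginal (hP c) g ha)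
    have hpa : 0 < p a := by
      rw [hpP]
      exact h0.trans_le (Finset.single_le_sum (f := fun c => l c * P c a)
        (fun c _ => mul_nonneg (hl c) (hP c a)) (Finset.mem_univ c))
    have hpm : 0 < marginal T p g (g a) := hpa.trans_le (le_marginal hp g ha)
    rw [marginal_id ha]
    have h1 := Real.log_le_sub_one_of_pos
      (div_pos (mul_pos (p a |> fun _ => hpa) hm) (mul_pos hpm hP0))
    rw [Real.log_div (by positivity) (by positivity), Real.log_mul hpa.ne' hm.ne',
      Real.log_mul hpm.ne' hP0.ne'] at h1
    have h2 := mul_le_mul_of_nonneg_left h1 h0.le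
    have h3 : l c * P c a * (p a * marginal T (P c) g (g a) / (marginal T p g (g a) * P c a) - 1)
        = p a / marginal T p g (g a) * (l c * marginal T (P c) g (g a)) - l c * P c a := by
      field_simp
    rw [h3] at h2
    linarith
  calc ∑ c, l c * (finEntropy T (P c) id - finEntropy T (P c) g)
      = ∑ c, ∑ a ∈ T, l c * (P c a * (-Real.log (marginal T (P c) id a))
      - P c a * (-Real.log (marginal T (P c) g (g a)))) := by
        refine Finset.sum_congr rfl fun c _ => ?_
        rw [← Finset.mul_sum, Finset.sum_sub_distrib]; rfl
    _ ≤ ∑ c, ∑ a ∈ T, (l c * P c a * (-Real.log (p a) + Real.log (marginal T p g (g a)))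
      + (p a / marginal T p g (g a) * (l c * marginal T (P c) g (g a)) - l c * P c a)) :=
        Finset.sum_le_sum fun c _ => Finset.sum_le_sum fun a ha => key c a ha
    _ = ∑ a ∈ T, (p a * (-Real.log (p a) + Real.log (marginal T p g (g a)))
      + (p a / marginal T p g (g a) * marginal T p g (g a) - p a)) := by
        rw [Finset.sum_comm]
        refine Finset.sum_congr rfl fun a _ => ?_
        rw [Finset.sum_add_distrib, Finset.sum_sub_distrib, ← Finset.sum_mul, ← Finset.mul_sum,
          ← hmarg, ← hpP]
    _ ≤ ∑ a ∈ T, p a * (-Real.log (p a) + Real.log (marginal T p g (g a))) := by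
        refine Finset.sum_le_sum fun a _ => ?_
        have : p a / marginal T p g (g a) * marginal T p g (g a) ≤ p a := by
          rcases eq_or_ne (marginal T p g (g a)) 0 with h | h
          · simpa [h] using hp a
          · rw [div_mul_cancel₀ _ h]
        linarith
    _ = finEntropy T p id - finEntropy T p g := by
        rw [finEntropy, finEntropy, ← Finset.sum_sub_distrib]
        refine Finset.sum_congr rfl fun a ha => ?_
        rw [id, marginal_id ha]; ring

end finite

/-! ### Entropy of discrete random variables and of partitions -/

/-- Entropy (natural logarithm) of the law of a discrete random variable. -/
noncomputable def mapEntropy {X ι : Type*} [MeasurableSpace X] (μ : Measure X) (F : X → ι) : ℝ :=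
  ∑' i, Real.negMulLog (μ.real (F ⁻¹' {i}))

/-- The nonempty cells of `𝒟` are the nonempty fibres of `F`. -/
def IsIndexedBy {X ι : Type*} (𝒟 : Set (Set X)) (F : X → ι) : Prop :=
  (∀ D ∈ 𝒟, ∀ x ∈ D, D = F ⁻¹' {F x}) ∧ ∀ x, F ⁻¹' {F x} ∈ 𝒟

section measure

variable {X ι β : Type*} [MeasurableSpace X] {μ : Measure X} {F : X → ι} {T : Finset ι}

lemma measureReal_fiber_eq_zero (hT : ∀ᵐ x ∂μ, F x ∈ T) {i : ι} (hi : i ∉ T) :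
    μ.real (F ⁻¹' {i}) = 0 := by
  have : μ (F ⁻¹' {i}) = 0 := measure_mono_null
    (fun x (hx : F x = i) => show ¬ (F x ∈ T) by rwa [hx]) (ae_iff.1 hT)
  simp [Measure.real, this]

lemma measureReal_comp_fiber [IsFiniteMeasure μ] (hF : ∀ i, MeasurableSet (F ⁻¹' {i}))
    (hT : ∀ᵐ x ∂μ, F x ∈ T) (f : ι → β) (b : β) :
    μ.real ((f ∘ F) ⁻¹' {b}) = marginal T (fun i => μ.real (F ⁻¹' {i})) f b := by
  classical
  have h1 : μ.real ((f ∘ F) ⁻¹' {b}) =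
      μ.real (⋃ i ∈ T.filter (fun i => f i = b), F ⁻¹' {i}) := by
    refine measureReal_congr ?_
    filter_upwards [hT] with x hx
    change (f (F x) = b) = (x ∈ (⋃ i ∈ T.filter (fun i => f i = b), F ⁻¹' {i} : Set X))
    simp [hx]
  rw [h1, measureReal_biUnion_finset]
  · unfold marginal; congr
  · intro i _ j _ hij
    exact Set.disjoint_left.2 fun x (hx : F x = i) (hx' : F x = j) => hij (hx ▸ hx')
  · exact fun i _ => hF i

lemma sum_measureReal_fiber [IsProbabilityMeasure μ] (hF : ∀ i, MeasurableSet (F ⁻¹' {i}))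
    (hT : ∀ᵐ x ∂μ, F x ∈ T) : ∑ i ∈ T, μ.real (F ⁻¹' {i}) = 1 := by
  have := measureReal_comp_fiber hF hT (fun _ => ()) ()
  have h1 : (fun _ => ()) ∘ F ⁻¹' {()} = Set.univ := by ext; simp
  rw [h1] at this
  simpa [marginal] using this.symm

lemma mapEntropy_comp [IsFiniteMeasure μ] (hF : ∀ i, MeasurableSet (F ⁻¹' {i}))
    (hT : ∀ᵐ x ∂μ, F x ∈ T) (f : ι → β) :
    mapEntropy μ (f ∘ F) = finEntropy T (fun i => μ.real (F ⁻¹' {i})) f := by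
  classical
  rw [finEntropy_eq_sum_negMulLog, mapEntropy, tsum_eq_sum (s := T.image f)]
  · exact Finset.sum_congr rfl fun b _ => by rw [measureReal_comp_fiber hF hT]
  · intro b hb
    have hT' : ∀ᵐ x ∂μ, (f ∘ F) x ∈ T.image f := by
      filter_upwards [hT] with x hx using Finset.mem_image_of_mem f hx
    rw [measureReal_fiber_eq_zero hT' hb, Real.negMulLog_zero]

lemma mapEntropy_eq_finEntropy [IsFiniteMeasure μ] (hF : ∀ i, MeasurableSet (F ⁻¹' {i}))
    (hT : ∀ᵐ x ∂μ, F x ∈ T) :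
    mapEntropy μ F = finEntropy T (fun i => μ.real (F ⁻¹' {i})) id :=
  mapEntropy_comp hF hT id

lemma mapEntropy_eq_sum (hT : ∀ᵐ x ∂μ, F x ∈ T) :
    mapEntropy μ F = ∑ i ∈ T, Real.negMulLog (μ.real (F ⁻¹' {i})) :=
  tsum_eq_sum fun i hi => by rw [measureReal_fiber_eq_zero hT hi, Real.negMulLog_zero]

lemma measureReal_cond {s : Set X} (hs : MeasurableSet s) (μ : Measure X) (t : Set X) :
    (cond μ s).real t = (μ.real s)⁻¹ * μ.real (s ∩ t) := by
  rw [Measure.real, cond_apply hs, ENNReal.toReal_mul, ENNReal.toReal_inv]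
  rfl

/-- The chain rule: on each fibre of `g`, the normalising factor of the conditional measure
contributes exactly the logarithm of the marginal. -/
lemma sum_mul_mapEntropy_cond [IsFiniteMeasure μ] [DecidableEq β]
    (hF : ∀ i, MeasurableSet (F ⁻¹' {i}))
    (hT : ∀ᵐ x ∂μ, F x ∈ T) (g : ι → β) (hg : ∀ b, MeasurableSet ((g ∘ F) ⁻¹' {b})) :
    ∑ b ∈ T.image g, μ.real ((g ∘ F) ⁻¹' {b}) * mapEntropy (cond μ ((g ∘ F) ⁻¹' {b})) F =
      mapEntropy μ F - mapEntropy μ (g ∘ F) := by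
  classical
  rw [mapEntropy_comp hF hT g, mapEntropy_eq_finEntropy hF hT]
  set p : ι → ℝ := fun i => μ.real (F ⁻¹' {i}) with hp
  have hp0 : ∀ i, 0 ≤ p i := fun i => measureReal_nonneg
  rw [finEntropy, finEntropy, ← Finset.sum_sub_distrib,
    ← Finset.sum_fiberwise_of_maps_to (t := T.image g) (g := g)
    (fun a ha => Finset.mem_image_of_mem g ha)]
  refine Finset.sum_congr rfl fun b hb => ?_
  have hTb : ∀ᵐ x ∂(cond μ ((g ∘ F) ⁻¹' {b})), F x ∈ T :=
    cond_absolutelyContinuous.ae_le hT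
  rw [mapEntropy_eq_sum hTb, Finset.mul_sum, Finset.sum_filter]
  refine Finset.sum_congr rfl fun i hi => ?_
  rw [measureReal_cond (hg b), measureReal_comp_fiber hF hT g b]
  by_cases hib : g i = b
  · have hinter : (g ∘ F) ⁻¹' {b} ∩ F ⁻¹' {i} = F ⁻¹' {i} :=
      Set.inter_eq_right.2 fun x (hx : F x = i) => by simp [hx, hib]
    rw [if_pos hib, hinter, id, marginal_id (p := p) hi, ← hib, ← hp]
    change marginal T p g (g i) * Real.negMulLog ((marginal T p g (g i))⁻¹ * p i) = _
    rcases (hp0 i).eq_or_lt with h0 | h0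
    · simp [← h0]
    have hm := h0.trans_le (le_marginal hp0 g hi)
    rw [Real.negMulLog, Real.log_mul (by positivity) h0.ne', Real.log_inv]
    field_simp
    ring
  · have hinter : (g ∘ F) ⁻¹' {b} ∩ F ⁻¹' {i} = ∅ := by
      ext x
      simp only [Set.mem_inter_iff, Set.mem_preimage, Set.mem_singleton_iff, Function.comp_apply,
        Set.mem_empty_iff_false, iff_false, not_and]
      rintro h1 rfl
      exact hib h1
    simp [hinter, hib]

/-- Passes from sums over a set of cells to sums over indices. Indices with empty fibre all give the
same cell `∅`, so injectivity holds only on nonempty fibres; vanishing of `h` on null cells makes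
the others harmless. -/
lemma tsum_partition {𝒟 : Set (Set X)} (h𝒟 : IsIndexedBy 𝒟 F) (hT : ∀ᵐ x ∂μ, F x ∈ T)
    (h : Set X → ℝ) (h0 : ∀ D, μ D = 0 → h D = 0) :
    ∑' D : 𝒟, h D.1 = ∑ i ∈ T, h (F ⁻¹' {i}) := by
  classical
  rw [tsum_subtype 𝒟 h]
  have hsub : ∑ i ∈ T.filter (fun i => (F ⁻¹' {i}).Nonempty), h (F ⁻¹' {i}) =
      ∑ i ∈ T, h (F ⁻¹' {i}) := by
    refine Finset.sum_filter_of_ne fun i _ hi => ?_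
    by_contra hne
    rw [Set.not_nonempty_iff_eq_empty] at hne
    exact hi (h0 _ (by simp [hne]))
  rw [← hsub, tsum_eq_sum (s := (T.filter (fun i => (F ⁻¹' {i}).Nonempty)).image
    fun i => F ⁻¹' {i}), Finset.sum_image]
  · refine Finset.sum_congr rfl fun i hi => ?_
    obtain ⟨x, rfl⟩ := (Finset.mem_filter.1 hi).2
    exact Set.indicator_of_mem (h𝒟.2 x) _
  · intro i hi j hj hij
    obtain ⟨x, hx⟩ := (Finset.mem_filter.1 hi).2
    have hx' : x ∈ F ⁻¹' {j} := by
      have : F ⁻¹' {i} = F ⁻¹' {j} := hij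
      rwa [← this]
    exact (show F x = i from hx).symm.trans hx'
  · intro D hD
    by_cases hmem : D ∈ 𝒟
    · rw [Set.indicator_of_mem hmem]
      rcases D.eq_empty_or_nonempty with rfl | ⟨x, hx⟩
      · exact h0 _ (by simp)
      · have hDx := h𝒟.1 D hmem x hx
        refine h0 _ ?_
        by_contra hne
        refine hD (Finset.mem_image.2 ⟨F x, Finset.mem_filter.2 ⟨?_, ⟨x, rfl⟩⟩, hDx.symm⟩)
        by_contra hxT
        refine hne (measure_mono_null (fun y hy => ?_) (ae_iff.1 hT))
        rw [hDx] at hy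
        rw [Set.mem_ofPred_eq, show F y = F x from hy]
        exact hxT
    · exact Set.indicator_of_notMem hmem _

lemma entropy_mul_log_two {𝒟 : Set (Set X)} (h𝒟 : IsIndexedBy 𝒟 F) (hT : ∀ᵐ x ∂μ, F x ∈ T) :
    entropy μ 𝒟 * Real.log 2 = mapEntropy μ F := by
  rw [entropy, tsum_partition h𝒟 hT (fun D => μ.real D * Real.logb 2 (μ.real D))
    (fun D hD => by simp [Measure.real, hD]), mapEntropy_eq_sum hT, ← Finset.sum_neg_distrib,
    Finset.sum_mul]
  refine Finset.sum_congr rfl fun i _ => ?_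
  have : Real.log 2 ≠ 0 := (Real.log_pos one_lt_two).ne'
  rw [Real.negMulLog, Real.logb]
  field_simp

lemma condEntropy_mul_log_two [IsFiniteMeasure μ] {𝒟 ℰ : Set (Set X)} (h𝒟 : IsIndexedBy 𝒟 F)
    (g : ι → β) (hℰ : IsIndexedBy ℰ (g ∘ F)) (hF : ∀ i, MeasurableSet (F ⁻¹' {i}))
    (hg : ∀ b, MeasurableSet ((g ∘ F) ⁻¹' {b})) (hT : ∀ᵐ x ∂μ, F x ∈ T) :
    condEntropy μ 𝒟 ℰ * Real.log 2 = mapEntropy μ F - mapEntropy μ (g ∘ F) := by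
  classical
  have hT' : ∀ᵐ x ∂μ, (g ∘ F) x ∈ T.image g := by
    filter_upwards [hT] with x hx using Finset.mem_image_of_mem g hx
  rw [← sum_mul_mapEntropy_cond hF hT g hg, condEntropy,
    tsum_partition hℰ hT' (fun E => μ.real E * entropy (cond μ E) 𝒟)
    (fun D hD => by simp [Measure.real, hD]), Finset.sum_mul]
  refine Finset.sum_congr rfl fun b _ => ?_
  rw [mul_assoc, entropy_mul_log_two h𝒟 (cond_absolutelyContinuous.ae_le hT)]

end measure

/-! ### Indices of dyadic boxes and their entropies -/

variable {d : ℕ}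

/-- Index of the dyadic interval of level `N` containing the `j`-th coordinate. -/
noncomputable def coordIndex (N : ℤ) (j : Fin d) (x : EuclideanSpace ℝ (Fin d)) : ℤ :=
  ⌊(2 : ℝ) ^ N * x j⌋

/-- Index of the dyadic box with levels `N` containing a point. -/
noncomputable def boxIndex (N : Fin d → ℤ) (x : EuclideanSpace ℝ (Fin d)) : Fin d → ℤ :=
  fun j => coordIndex (N j) j x

/-- Almost sure boundedness of a measure. -/
def IsBoundedMeasure (μ : Measure (EuclideanSpace ℝ (Fin d))) : Prop :=
  ∃ R : ℝ, ∀ᵐ x ∂μ, ‖x‖ ≤ R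

lemma measurable_coordIndex (N : ℤ) (j : Fin d) : Measurable (coordIndex N j) := by
  unfold coordIndex
  fun_prop

lemma measurable_boxIndex (N : Fin d → ℤ) : Measurable (boxIndex N) :=
  measurable_pi_lambda _ fun j => measurable_coordIndex (N j) j

lemma measurableSet_boxIndex_fiber (N : Fin d → ℤ) (i : Fin d → ℤ) :
    MeasurableSet (boxIndex N ⁻¹' {i}) :=
  measurable_boxIndex N (measurableSet_singleton i)

lemma coordIndex_coarsen {N' N : ℤ} (h : N' ≤ N) (j : Fin d) (x : EuclideanSpace ℝ (Fin d)) :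
    coordIndex N' j x = coordIndex N j x / ((2 ^ (N - N').toNat : ℕ) : ℤ) := by
  rw [coordIndex, coordIndex, ← Int.floor_div_natCast]
  congr 1
  have h1 : (((2 ^ (N - N').toNat : ℕ) : ℕ) : ℝ) = (2 : ℝ) ^ (N - N') := by
    rw [Nat.cast_pow, ← zpow_natCast, Int.toNat_of_nonneg (by omega)]; simp
  rw [h1, zpow_sub₀ two_ne_zero]
  have : (2 : ℝ) ^ N ≠ 0 := by positivity
  field_simp

/-- The map sending the index of a box to the index of the coarser box containing it. -/
def coarsen (N' N : Fin d → ℤ) (i : Fin d → ℤ) : Fin d → ℤ :=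
  fun j => i j / ((2 ^ (N j - N' j).toNat : ℕ) : ℤ)

lemma coarsen_comp_boxIndex {N' N : Fin d → ℤ} (h : N' ≤ N) :
    coarsen N' N ∘ boxIndex N = boxIndex N' := by
  funext x j
  exact (coordIndex_coarsen (h j) j x).symm

lemma IsBoundedMeasure.exists_finset {μ : Measure (EuclideanSpace ℝ (Fin d))}
    (hμ : IsBoundedMeasure μ) (N : Fin d → ℤ) :
    ∃ T : Finset (Fin d → ℤ), ∀ᵐ x ∂μ, boxIndex N x ∈ T := by
  obtain ⟨R, hR⟩ := hμ
  refine ⟨Fintype.piFinset fun j => Finset.Icc ⌊-((2 : ℝ) ^ N j * R)⌋ ⌊(2 : ℝ) ^ N j * R⌋, ?_⟩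
  filter_upwards [hR] with x hx
  refine Fintype.mem_piFinset.2 fun j => Finset.mem_Icc.2 ?_
  have h1 : |x j| ≤ R := (PiLp.norm_apply_le x j).trans hx
  have h2 := abs_le.1 h1
  have h3 : (0 : ℝ) < 2 ^ N j := by positivity
  refine ⟨Int.floor_le_floor ?_, Int.floor_le_floor ?_⟩
  · nlinarith
  · nlinarith

section entropies

variable {μ : Measure (EuclideanSpace ℝ (Fin d))}

lemma mapEntropy_coord_le [IsFiniteMeasure μ] (hμ : IsBoundedMeasure μ) (N : Fin d → ℤ)
    (j : Fin d) : mapEntropy μ (coordIndex (N j) j) ≤ mapEntropy μ (boxIndex N) := by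
  obtain ⟨T, hT⟩ := hμ.exists_finset N
  have h1 := mapEntropy_comp (measurableSet_boxIndex_fiber N) hT (fun i => i j)
  have h2 := mapEntropy_comp (measurableSet_boxIndex_fiber N) hT id
  rw [Function.id_comp] at h2
  rw [h2, show coordIndex (N j) j = (fun i : Fin d → ℤ => i j) ∘ boxIndex N from rfl, h1]
  exact finEntropy_mono (fun _ => measureReal_nonneg) fun a _ a' _ h => congrFun h j

lemma mapEntropy_box_le_sum [IsProbabilityMeasure μ] (hμ : IsBoundedMeasure μ)
    (N : Fin d → ℤ) :
    mapEntropy μ (boxIndex N) ≤ ∑ j, mapEntropy μ (coordIndex (N j) j) := by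
  obtain ⟨T, hT⟩ := hμ.exists_finset N
  have h1 := fun j => mapEntropy_comp (measurableSet_boxIndex_fiber N) hT (fun i => i j)
  rw [mapEntropy_eq_finEntropy (measurableSet_boxIndex_fiber N) hT]
  refine (finEntropy_le_sum (fun _ => measureReal_nonneg)
    (sum_measureReal_fiber (measurableSet_boxIndex_fiber N) hT)
    (fun j i => i j) fun a _ a' _ h => funext h).trans ?_
  exact Finset.sum_le_sum fun j _ => (h1 j).ge

lemma mapEntropy_box_mono [IsFiniteMeasure μ] (hμ : IsBoundedMeasure μ) {N' N : Fin d → ℤ}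
    (h : N' ≤ N) : mapEntropy μ (boxIndex N') ≤ mapEntropy μ (boxIndex N) := by
  obtain ⟨T, hT⟩ := hμ.exists_finset N
  rw [← coarsen_comp_boxIndex h, mapEntropy_comp (measurableSet_boxIndex_fiber N) hT,
    mapEntropy_eq_finEntropy (measurableSet_boxIndex_fiber N) hT]
  exact finEntropy_mono (fun _ => measureReal_nonneg) fun a _ a' _ h => congrArg _ h

/-- Conditional box entropy is concave in the measure. -/
lemma mapEntropy_box_sub_concave {κ : Type*} [Fintype κ] {ν : Measure (EuclideanSpace ℝ (Fin d))}
    [IsFiniteMeasure ν] (hν : IsBoundedMeasure ν) (l : κ → ℝ)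
    (P : κ → Measure (EuclideanSpace ℝ (Fin d))) [∀ c, IsFiniteMeasure (P c)]
    (hP : ∀ c, IsBoundedMeasure (P c))
    (hl : ∀ c, 0 ≤ l c)
    (h : ∀ s, MeasurableSet s → ν.real s = ∑ c, l c * (P c).real s) {N' N : Fin d → ℤ}
    (hN : N' ≤ N) :
    ∑ c, l c * (mapEntropy (P c) (boxIndex N) - mapEntropy (P c) (boxIndex N')) ≤
      mapEntropy ν (boxIndex N) - mapEntropy ν (boxIndex N') := by
  classical
  obtain ⟨T₀, hT₀⟩ := hν.exists_finset N
  choose T₁ hT₁ using fun c => (hP c).exists_finset N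
  set T := T₀ ∪ Finset.univ.biUnion T₁
  have hT : ∀ᵐ x ∂ν, boxIndex N x ∈ T := by
    filter_upwards [hT₀] with x hx using Finset.mem_union_left _ hx
  have hTc : ∀ c, ∀ᵐ x ∂P c, boxIndex N x ∈ T := fun c => by
    filter_upwards [hT₁ c] with x hx using
      Finset.mem_union_right _ (Finset.mem_biUnion.2 ⟨c, Finset.mem_univ c, hx⟩)
  rw [← coarsen_comp_boxIndex hN, mapEntropy_comp (measurableSet_boxIndex_fiber N) hT,
    mapEntropy_eq_finEntropy (measurableSet_boxIndex_fiber N) hT]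
  refine le_trans (le_of_eq ?_) (finEntropy_sub_concave (T := T) l
    (fun c i => (P c).real (boxIndex N ⁻¹' {i})) hl
    (fun _ _ => measureReal_nonneg) (fun i => h _ (measurableSet_boxIndex_fiber N i))
    (coarsen N' N))
  refine Finset.sum_congr rfl fun c _ => ?_
  rw [mapEntropy_comp (measurableSet_boxIndex_fiber N) (hTc c),
    mapEntropy_eq_finEntropy (measurableSet_boxIndex_fiber N) (hTc c)]

end entropies

/-! ### The partitions `ℰ_n` and the tubes as box partitions -/

section partitions

lemma mem_Ico_dyadic_iff {n k : ℤ} {y : ℝ} :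
    y ∈ Set.Ico ((k : ℝ) / 2 ^ n) (((k : ℝ) + 1) / 2 ^ n) ↔ ⌊(2 : ℝ) ^ n * y⌋ = k := by
  have h : (0 : ℝ) < 2 ^ n := by positivity
  rw [Int.floor_eq_iff, Set.mem_Ico, div_le_iff₀' h, lt_div_iff₀' h]

lemma mem_dyadicPartition_iff {n : ℤ} {D : Set ℝ} :
    D ∈ dyadicPartition n ↔ ∃ k : ℤ, D = {y | ⌊(2 : ℝ) ^ n * y⌋ = k} := by
  refine exists_congr fun k => ?_
  rw [show Set.Ico ((k : ℝ) / 2 ^ n) (((k : ℝ) + 1) / 2 ^ n) = {y | ⌊(2 : ℝ) ^ n * y⌋ = k} from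
    Set.ext fun y => mem_Ico_dyadic_iff]

/-- The levels of the partition `ℰ_n`. -/
noncomputable def level (χ : Fin d → ℝ) (n : ℤ) : Fin d → ℤ := fun j => ⌊χ j * (n : ℝ)⌋

lemma level_mono {χ : Fin d → ℝ} (hχ : ∀ j, 0 < χ j) : Monotone (level χ) := fun a b hab j =>
  Int.floor_le_floor (mul_le_mul_of_nonneg_left (by exact_mod_cast hab) (hχ j).le)

lemma mem_partitionE_iff {χ : Fin d → ℝ} {n : ℤ} {E : Set (EuclideanSpace ℝ (Fin d))} :
    E ∈ partitionE χ n ↔ ∃ k : Fin d → ℤ, E = boxIndex (level χ n) ⁻¹' {k} := by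
  have key : ∀ k : Fin d → ℤ, boxIndex (level χ n) ⁻¹' {k} =
      {x | ∀ j, x j ∈ {y : ℝ | ⌊(2 : ℝ) ^ ⌊χ j * (n : ℝ)⌋ * y⌋ = k j}} := fun k =>
    Set.ext fun x => funext_iff
  constructor
  · rintro ⟨D, hD, rfl⟩
    choose k hk using fun j => mem_dyadicPartition_iff.1 (hD j)
    refine ⟨k, ?_⟩
    rw [key]
    simp only [← hk]
  · rintro ⟨k, rfl⟩
    exact ⟨_, fun j => mem_dyadicPartition_iff.2 ⟨k j, rfl⟩, key k⟩

lemma partitionE_isIndexedBy (χ : Fin d → ℝ) (n : ℤ) :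
    IsIndexedBy (partitionE χ n) (boxIndex (level χ n)) := by
  refine ⟨fun D hD x hx => ?_, fun x => mem_partitionE_iff.2 ⟨_, rfl⟩⟩
  obtain ⟨k, rfl⟩ := mem_partitionE_iff.1 hD
  rw [show boxIndex (level χ n) x = k from hx]

/-- Levels of the partition into tubes in direction `j`. -/
def tubeLevel (N' N : Fin d → ℤ) (j : Fin d) : Fin d → ℤ := Function.update N j (N' j)

lemma tubeLevel_le {N' N : Fin d → ℤ} (h : N' ≤ N) (j : Fin d) : tubeLevel N' N j ≤ N :=
  update_le_self_iff.2 (h j)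

/-- The projection sets coordinate `j` to zero, so the fine partition puts no constraint on it. In
the other coordinates the fine index determines the coarse one. What remains is a box of level `N'
j` in direction `j` and level `N i` elsewhere. -/
lemma tube_fiber {N' N : Fin d → ℤ} (h : N' ≤ N) (j : Fin d) (x : EuclideanSpace ℝ (Fin d)) :
    boxIndex N' ⁻¹' {boxIndex N' x} ∩
      coordProj ({j}ᶜ : Finset (Fin d)) ⁻¹' (boxIndex N ⁻¹'
        {boxIndex N (coordProj ({j}ᶜ : Finset (Fin d)) x)}) =
      boxIndex (tubeLevel N' N j) ⁻¹' {boxIndex (tubeLevel N' N j) x} := by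
  ext y
  simp only [Set.mem_inter_iff, Set.mem_preimage, Set.mem_singleton_iff, funext_iff]
  have hp : ∀ i (z : EuclideanSpace ℝ (Fin d)), boxIndex N (coordProj ({j}ᶜ : Finset (Fin d)) z) i
      = if i = j then 0 else boxIndex N z i := by
    intro i z
    by_cases hi : i = j <;> simp [boxIndex, coordIndex, coordProj, hi]
  have ht : ∀ i (z : EuclideanSpace ℝ (Fin d)), boxIndex (tubeLevel N' N j) z i =
      if i = j then boxIndex N' z i else boxIndex N z i := by
    intro i z
    by_cases hi : i = j
    · subst hi; simp [boxIndex, tubeLevel]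
    · simp [boxIndex, tubeLevel, hi]
  simp only [hp, ht]
  constructor
  · rintro ⟨h1, h2⟩ i
    by_cases hi : i = j
    · simp only [hi, if_true]; exact h1 j
    · simpa [hi] using h2 i
  · intro h1
    refine ⟨fun i => ?_, fun i => ?_⟩
    · by_cases hi : i = j
      · simpa [hi] using h1 i
      · have := h1 i
        simp only [hi, if_false] at this
        change coordIndex (N i) i y = coordIndex (N i) i x at this
        change coordIndex (N' i) i y = coordIndex (N' i) i x
        rw [coordIndex_coarsen (h i), this, ← coordIndex_coarsen (h i)]
    · by_cases hi : i = j
      · simp [hi]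
      · simpa [hi] using h1 i

lemma tubePartition_isIndexedBy {χ : Fin d → ℝ} {a b : ℤ} (hab : level χ a ≤ level χ b)
    (j : Fin d) :
    IsIndexedBy (joinPartition (partitionE χ a)
      (preimagePartition (coordProj ({j}ᶜ : Finset (Fin d))) (partitionE χ b)))
      (boxIndex (tubeLevel (level χ a) (level χ b) j)) := by
  refine ⟨?_, fun x => ?_⟩
  · rintro _ ⟨D, hD, _, ⟨C, hC, rfl⟩, rfl⟩ x ⟨hxD, hxC⟩
    rw [← tube_fiber hab, (partitionE_isIndexedBy χ a).1 D hD x hxD]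
    conv_lhs => rw [(partitionE_isIndexedBy χ b).1 C hC _ hxC]
  · rw [← tube_fiber hab]
    exact ⟨_, (partitionE_isIndexedBy χ a).2 x, _, ⟨_, (partitionE_isIndexedBy χ b).2 _, rfl⟩, rfl⟩

lemma tubeEntropy_mul_log_two {χ : Fin d → ℝ} (hχ : ∀ j, 0 < χ j)
    {θ : Measure (EuclideanSpace ℝ (Fin d))} {m k q : ℕ} [IsFiniteMeasure (selfConv θ k)]
    (hθ : IsBoundedMeasure (selfConv θ k)) (j : Fin d) :
    tubeEntropy χ θ j m k q * Real.log 2 =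
      mapEntropy (selfConv θ k) (boxIndex (level χ ((q : ℤ) + m))) -
      mapEntropy (selfConv θ k)
        (boxIndex (tubeLevel (level χ q) (level χ ((q : ℤ) + m)) j)) := by
  have hle : level χ (q : ℤ) ≤ level χ ((q : ℤ) + m) := level_mono hχ (by omega)
  obtain ⟨T, hT⟩ := hθ.exists_finset (level χ ((q : ℤ) + m))
  have hc := coarsen_comp_boxIndex (tubeLevel_le hle j)
  rw [← hc]
  refine condEntropy_mul_log_two (partitionE_isIndexedBy _ _) _ ?_
    (measurableSet_boxIndex_fiber _) ?_ hT
  · rw [hc]; exact tubePartition_isIndexedBy hle j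
  · rw [hc]; exact measurableSet_boxIndex_fiber _

end partitions

/-! ### Upper bound of entropy by variance -/

/-- The additive constant in the bound of the entropy of an integer valued variable by its
variance. -/
noncomputable def entropyConst : ℝ := (∑' i : ℤ, 1 / (1 + (i : ℝ) ^ 2)) + 3

lemma summable_int_one_div_one_add_sq : Summable fun i : ℤ => 1 / (1 + (i : ℝ) ^ 2) := by
  have h : Summable fun n : ℕ => 1 / (1 + (n : ℝ) ^ 2) := by
    refine Summable.of_nonneg_of_le (fun n => by positivity) (fun n => ?_)
      (((Real.summable_one_div_nat_pow (p := 2)).2 one_lt_two).add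
        (summable_of_ne_finset_zero (f := fun n : ℕ => if n = 0 then (1 : ℝ) else 0) (s := {0})
          (fun n hn => by simpa using hn)))
    rcases Nat.eq_zero_or_pos n with rfl | hn
    · simp
    · have : (0 : ℝ) < n := by exact_mod_cast hn
      simp only [hn.ne', if_false, add_zero]
      exact one_div_le_one_div_of_le (by positivity) (by linarith)
  exact Summable.of_nat_of_neg (by simpa using h) (by simpa using h)

lemma three_le_entropyConst : 3 ≤ entropyConst := by
  have : 0 ≤ ∑' i : ℤ, 1 / (1 + (i : ℝ) ^ 2) := tsum_nonneg fun i => by positivity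
  unfold entropyConst
  linarith

lemma sum_one_div_one_add_sub_sq_le (T : Finset ℤ) (i₀ : ℤ) :
    ∑ i ∈ T, 1 / (1 + ((i : ℝ) - i₀) ^ 2) ≤ entropyConst - 3 := by
  have h : ∑ i ∈ T, 1 / (1 + ((i : ℝ) - i₀) ^ 2) =
      ∑ i ∈ T.map (Equiv.subRight i₀).toEmbedding, 1 / (1 + (i : ℝ) ^ 2) := by
    rw [Finset.sum_map]
    exact Finset.sum_congr rfl fun i _ => by simp
  rw [h, entropyConst, add_sub_cancel_right]
  exact summable_int_one_div_one_add_sq.sum_le_tsum _ fun i _ => by positivity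

lemma sum_floor_sq_le {X : Type*} [MeasurableSpace X] {μ : Measure X} [IsProbabilityMeasure μ]
    {Z : X → ℝ} (hZ : Measurable Z) (hZ2 : MemLp Z 2 μ) (T : Finset ℤ) :
    ∑ i ∈ T, μ.real ((fun x => ⌊Z x⌋) ⁻¹' {i}) * ((i : ℝ) - ⌊∫ x, Z x ∂μ⌋) ^ 2 ≤
      2 * variance Z μ + 2 := by
  classical
  set m := ∫ x, Z x ∂μ with hm
  have hmeas : ∀ i : ℤ, MeasurableSet ((fun x => ⌊Z x⌋) ⁻¹' {i}) := fun i =>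
    (Int.measurable_floor.comp hZ) (measurableSet_singleton i)
  have hint : Integrable (fun x => (Z x - m) ^ 2) μ :=
    (hZ2.sub (memLp_const m)).integrable_sq
  have h1 : ∀ i : ℤ, μ.real ((fun x => ⌊Z x⌋) ⁻¹' {i}) * ((i : ℝ) - ⌊m⌋) ^ 2 =
      ∫ x, ((fun x => ⌊Z x⌋) ⁻¹' {i}).indicator (fun _ => ((i : ℝ) - ⌊m⌋) ^ 2) x ∂μ := fun i => by
    rw [integral_indicator_const _ (hmeas i), smul_eq_mul]
  simp only [h1]
  rw [← integral_finsetSum _ fun i _ => (integrable_const _).indicator (hmeas i)]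
  rw [variance_eq_integral hZ.aemeasurable]
  have h2 : 2 * ∫ x, (Z x - m) ^ 2 ∂μ + 2 = ∫ x, (2 * (Z x - m) ^ 2 + 2) ∂μ := by
    rw [integral_add (hint.const_mul 2) (integrable_const _), integral_const_mul]
    simp
  rw [h2]
  refine integral_mono (integrable_finsetSum _ fun i _ => (integrable_const _).indicator (hmeas i))
    ((hint.const_mul 2).add (integrable_const _)) fun x => ?_
  have h3 : ∑ i ∈ T, ((fun x => ⌊Z x⌋) ⁻¹' {i}).indicator (fun _ => ((i : ℝ) - ⌊m⌋) ^ 2) x ≤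
      ((⌊Z x⌋ : ℝ) - ⌊m⌋) ^ 2 := by
    have : ∀ i ∈ T, ((fun x => ⌊Z x⌋) ⁻¹' {i}).indicator (fun _ => ((i : ℝ) - ⌊m⌋) ^ 2) x =
        if ⌊Z x⌋ = i then ((⌊Z x⌋ : ℝ) - ⌊m⌋) ^ 2 else 0 := fun i _ => by
      by_cases h : ⌊Z x⌋ = i
      · rw [Set.indicator_of_mem (show x ∈ _ from h), if_pos h, h]
      · rw [Set.indicator_of_notMem (show x ∉ _ from h), if_neg h]
    rw [Finset.sum_congr rfl this, Finset.sum_ite_eq]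
    split_ifs
    · exact le_rfl
    · positivity
  refine h3.trans ?_
  have a1 := Int.floor_le (Z x)
  have a2 := Int.lt_floor_add_one (Z x)
  have a3 := Int.floor_le m
  have a4 := Int.lt_floor_add_one m
  -- Rounding both `Z` and its mean moves the difference by at most one, and `(u + e)^2 ≤ 2 u^2 + 2`
  -- when `|e| ≤ 1`.
  have a5 : |(⌊Z x⌋ : ℝ) - ⌊m⌋ - (Z x - m)| ≤ 1 := abs_le.2 ⟨by linarith, by linarith⟩
  have a6 := sq_le_one_iff_abs_le_one _ |>.2 a5
  nlinarith [sq_nonneg ((⌊Z x⌋ : ℝ) - ⌊m⌋ - 2 * (Z x - m))]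

lemma log_le_tangent {x t : ℝ} (hx : 0 < x) (ht : 0 < t) :
    Real.log x ≤ Real.log t + x / t - 1 := by
  have := Real.log_le_sub_one_of_pos (div_pos hx ht)
  rw [Real.log_div hx.ne' ht.ne'] at this
  linarith

/-- Gibbs' inequality with the summable weight `1 / (1 + (i - i₀)^2)`, followed by Jensen for the
logarithm, done through its tangent at `t = 3 (1 + Var Z)`. -/
lemma mapEntropy_floor_le {X : Type*} [MeasurableSpace X] {μ : Measure X}
    [IsProbabilityMeasure μ] {Z : X → ℝ} (hZ : Measurable Z) (hZ2 : MemLp Z 2 μ)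
    {T : Finset ℤ} (hT : ∀ᵐ x ∂μ, ⌊Z x⌋ ∈ T) :
    mapEntropy μ (fun x => ⌊Z x⌋) ≤ entropyConst + Real.log (1 + variance Z μ) := by
  have hmeas : ∀ i : ℤ, MeasurableSet ((fun x => ⌊Z x⌋) ⁻¹' {i}) := fun i =>
    (Int.measurable_floor.comp hZ) (measurableSet_singleton i)
  set i₀ := ⌊∫ x, Z x ∂μ⌋
  set p : ℤ → ℝ := fun i => μ.real ((fun x => ⌊Z x⌋) ⁻¹' {i}) with hp
  have hp0 : ∀ i, 0 ≤ p i := fun i => measureReal_nonneg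
  have hp1 : ∑ i ∈ T, p i = 1 := sum_measureReal_fiber hmeas hT
  have hE := sum_floor_sq_le hZ hZ2 T
  have hV := variance_nonneg Z μ
  rw [mapEntropy_eq_finEntropy hmeas hT]
  have h1 := finEntropy_le_of_weight (T := T) hp0 id (fun i => 1 / (1 + ((i : ℝ) - i₀) ^ 2))
    (fun i => by positivity) (fun i _ _ => by positivity)
  rw [Finset.image_id, hp1] at h1
  have h2 := sum_one_div_one_add_sub_sq_le T i₀
  set t : ℝ := 3 * (1 + variance Z μ) with ht
  have ht0 : 0 < t := by positivity
  have h3 : ∑ i ∈ T, p i * (-Real.log (1 / (1 + ((id i : ℤ) - (i₀ : ℝ)) ^ 2))) ≤ Real.log t := by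
    calc _ ≤ ∑ i ∈ T, (p i * (Real.log t - 1) + (p i + p i * ((i : ℝ) - i₀) ^ 2) / t) := by
          refine Finset.sum_le_sum fun i _ => ?_
          have := log_le_tangent (x := 1 + ((i : ℝ) - i₀) ^ 2) (by positivity) ht0
          rw [one_div, Real.log_inv, neg_neg]
          calc _ ≤ p i * (Real.log t + (1 + ((i : ℝ) - i₀) ^ 2) / t - 1) :=
                mul_le_mul_of_nonneg_left this (hp0 i)
            _ = _ := by ring
      _ = (Real.log t - 1) + (1 + ∑ i ∈ T, p i * ((i : ℝ) - i₀) ^ 2) / t := by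
          rw [Finset.sum_add_distrib, ← Finset.sum_mul, hp1, ← Finset.sum_div,
            Finset.sum_add_distrib, hp1, one_mul]
      _ ≤ (Real.log t - 1) + 1 := by
          gcongr
          rw [div_le_one ht0]
          linarith
      _ = Real.log t := by ring
  have h4 : Real.log t ≤ 2 + Real.log (1 + variance Z μ) := by
    rw [ht, Real.log_mul (by norm_num) (by positivity)]
    have : Real.log 3 ≤ 3 - 1 := Real.log_le_sub_one_of_pos (by norm_num)
    linarith
  linarith

section coords

lemma IsBoundedMeasure.memLp_coord {μ : Measure (EuclideanSpace ℝ (Fin d))} [IsFiniteMeasure μ]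
    (hμ : IsBoundedMeasure μ) (j : Fin d) : MemLp (fun x => x j) 2 μ := by
  obtain ⟨R, hR⟩ := hμ
  refine MemLp.of_bound (by fun_prop) R ?_
  filter_upwards [hR] with x hx using (PiLp.norm_apply_le x j).trans hx

lemma mapEntropy_coord_le_log {μ : Measure (EuclideanSpace ℝ (Fin d))} [IsProbabilityMeasure μ]
    (hμ : IsBoundedMeasure μ) (N : ℤ) (j : Fin d) :
    mapEntropy μ (coordIndex N j) ≤
      entropyConst + Real.log (1 + 4 ^ N * variance (fun x => x j) μ) := by
  classical
  obtain ⟨T, hT⟩ := hμ.exists_finset (fun _ => N)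
  have h : ∀ᵐ x ∂μ, ⌊(2 : ℝ) ^ N * x j⌋ ∈ T.image fun i => i j := by
    filter_upwards [hT] with x hx
    exact Finset.mem_image.2 ⟨_, hx, rfl⟩
  have h1 := mapEntropy_floor_le (Z := fun x : EuclideanSpace ℝ (Fin d) => (2 : ℝ) ^ N * x j)
    (by fun_prop) ((hμ.memLp_coord j).const_mul _) h
  rw [variance_const_mul] at h1
  have h2 : ((2 : ℝ) ^ N) ^ 2 = 4 ^ N := by
    rw [← zpow_natCast, zpow_comm]; norm_num
  rwa [h2] at h1

end coords

/-! ### Convolution powers of a mixture -/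

section mixture

/-- Multilinearity of the product measure; the words `c` index the expansion. -/
lemma pi_eq_sum_smul {k : ℕ} {X κ : Type*} [MeasurableSpace X] [Fintype κ] {θ : Measure X}
    [SigmaFinite θ] (l : κ → ENNReal) (P : κ → Measure X)
    [∀ c, SigmaFinite (P c)] (hθ : θ = ∑ c, l c • P c) :
    Measure.pi (fun _ : Fin k => θ) =
      ∑ c : Fin k → κ, (∏ i, l (c i)) • Measure.pi (fun i => P (c i)) := by
  classical
  refine Measure.pi_eq fun s hs => ?_
  rw [Measure.finsetSum_apply]
  simp only [Measure.smul_apply, Measure.pi_pi, smul_eq_mul, ← Finset.prod_mul_distrib]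
  rw [hθ]
  simp only [Measure.finsetSum_apply, Measure.smul_apply, smul_eq_mul]
  rw [Finset.prod_univ_sum, Fintype.piFinset_univ]

/-- The law of a sum of independent vectors. -/
noncomputable def sumLaw {k : ℕ} (P : Fin k → Measure (EuclideanSpace ℝ (Fin d))) :
    Measure (EuclideanSpace ℝ (Fin d)) :=
  (Measure.pi P).map fun x => ∑ s, x s

lemma measurable_sum_vec {k : ℕ} :
    Measurable fun x : Fin k → EuclideanSpace ℝ (Fin d) => ∑ s, x s := by
  fun_prop

instance {k : ℕ} (P : Fin k → Measure (EuclideanSpace ℝ (Fin d)))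
    [∀ i, IsProbabilityMeasure (P i)] : IsProbabilityMeasure (sumLaw P) :=
  Measure.isProbabilityMeasure_map measurable_sum_vec.aemeasurable

lemma selfConv_eq_sumLaw (θ : Measure (EuclideanSpace ℝ (Fin d))) (k : ℕ) :
    selfConv θ k = sumLaw fun _ : Fin k => θ := rfl

lemma selfConv_real_eq_sum {k : ℕ} {κ : Type*} [Fintype κ]
    {θ : Measure (EuclideanSpace ℝ (Fin d))} [IsProbabilityMeasure θ] (l : κ → ℝ)
    (hl : ∀ c, 0 ≤ l c) (P : κ → Measure (EuclideanSpace ℝ (Fin d)))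
    [∀ c, IsProbabilityMeasure (P c)] (hθ : θ = ∑ c, ENNReal.ofReal (l c) • P c)
    {s : Set (EuclideanSpace ℝ (Fin d))} (hs : MeasurableSet s) :
    (selfConv θ k).real s =
      ∑ c : Fin k → κ, (∏ i, l (c i)) * (sumLaw fun i => P (c i)).real s := by
  rw [selfConv, Measure.real, Measure.map_apply measurable_sum_vec hs,
    pi_eq_sum_smul _ P hθ, Measure.finsetSum_apply, ENNReal.toReal_sum]
  · refine Finset.sum_congr rfl fun c _ => ?_
    rw [Measure.smul_apply, smul_eq_mul, ENNReal.toReal_mul, ENNReal.toReal_prod, sumLaw,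
      Measure.real, Measure.map_apply measurable_sum_vec hs]
    congr 1
    exact Finset.prod_congr rfl fun i _ => ENNReal.toReal_ofReal (hl _)
  · intro c _
    exact ENNReal.mul_ne_top (ENNReal.prod_ne_top fun i _ => ENNReal.ofReal_ne_top)
      (measure_ne_top _ _)

lemma isBoundedMeasure_sumLaw {k : ℕ} {P : Fin k → Measure (EuclideanSpace ℝ (Fin d))}
    [∀ i, IsProbabilityMeasure (P i)] (hP : ∀ i, IsBoundedMeasure (P i)) :
    IsBoundedMeasure (sumLaw P) := by
  choose R hR using hP
  refine ⟨∑ i, R i, ?_⟩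
  rw [sumLaw, ae_map_iff measurable_sum_vec.aemeasurable
    (measurableSet_le measurable_norm measurable_const)]
  have : ∀ i, ∀ᵐ x ∂Measure.pi P, ‖x i‖ ≤ R i := fun i =>
    (measurePreserving_eval P i).quasiMeasurePreserving.ae (hR i)
  filter_upwards [ae_all_iff.2 this] with x hx
  exact (norm_sum_le _ _).trans (Finset.sum_le_sum fun i _ => hx i)

lemma variance_sumLaw {k : ℕ} {P : Fin k → Measure (EuclideanSpace ℝ (Fin d))}
    [∀ i, IsProbabilityMeasure (P i)] (hP : ∀ i, IsBoundedMeasure (P i)) (j : Fin d) :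
    variance (fun x => x j) (sumLaw P) = ∑ i, variance (fun x => x j) (P i) := by
  rw [sumLaw, variance_map (by fun_prop) measurable_sum_vec.aemeasurable,
    ← variance_sum_pi fun i => (hP i).memLp_coord j]
  congr 1
  funext x
  simp

end mixture

/-! ### Characteristic functions and concentration of sums -/

/-- The characteristic function of the `j`-th coordinate. -/
noncomputable def coordCharFun (μ : Measure (EuclideanSpace ℝ (Fin d))) (j : Fin d) (t : ℝ) : ℂ :=
  ∫ x, Complex.exp ((t * x j : ℝ) * Complex.I) ∂μ

/-- Serves centred variables: the term `iu` integrates to zero, so removing it is free, and what is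
left has modulus visibly below one. The square of the modulus is `1 - 2 u sin u + u^2`. -/
lemma norm_exp_mul_I_sub_le {u : ℝ} (hu : |u| ≤ 1) :
    ‖Complex.exp (u * Complex.I) - u * Complex.I‖ ≤ 1 - u ^ 2 / 3 := by
  have h2 : u ^ 2 ≤ 1 := (sq_le_one_iff_abs_le_one u).2 hu
  have hre : (Complex.exp (u * Complex.I) - u * Complex.I).re = Real.cos u := by
    simp [Complex.exp_ofReal_mul_I_re]
  have him : (Complex.exp (u * Complex.I) - u * Complex.I).im = Real.sin u - u := by
    simp [Complex.exp_ofReal_mul_I_im]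
  refine abs_le_of_sq_le_sq' ?_ (by linarith) |>.2
  rw [← Complex.normSq_eq_norm_sq, Complex.normSq_apply, hre, him]
  have h3 : u ^ 2 - u ^ 4 / 6 ≤ u * Real.sin u := by
    have key : ∀ v : ℝ, 0 ≤ v → v - v ^ 3 / 6 ≤ Real.sin v := fun v hv => Real.sin_ge_sub_cube hv
    rcases le_total 0 u with h | h
    · nlinarith [key u h]
    · have := key (-u) (by linarith)
      rw [Real.sin_neg] at this
      nlinarith
  nlinarith [Real.sin_sq_add_cos_sq u, sq_nonneg (u ^ 2)]

lemma norm_coordCharFun_le {μ : Measure (EuclideanSpace ℝ (Fin d))} [IsProbabilityMeasure μ]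
    {j : Fin d} {a r t : ℝ} (h : ∀ᵐ x ∂μ, x j ∈ Set.Icc a (a + r)) (ht : |t| * r ≤ 1) :
    ‖coordCharFun μ j t‖ ≤ 1 - t ^ 2 * variance (fun x => x j) μ / 3 := by
  have hmeas : Measurable fun x : EuclideanSpace ℝ (Fin d) => x j := by fun_prop
  have hmem : MemLp (fun x : EuclideanSpace ℝ (Fin d) => x j) 2 μ := by
    refine MemLp.of_bound (by fun_prop) (max |a| |a + r|) ?_
    filter_upwards [h] with x hx
    exact abs_le_max_abs_abs hx.1 hx.2
  have hint : Integrable (fun x : EuclideanSpace ℝ (Fin d) => x j) μ :=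
    hmem.integrable one_le_two
  set m := ∫ x, x j ∂μ with hm
  have hm1 : a ≤ m := by
    have : ∫ _, a ∂μ ≤ ∫ x, x j ∂μ := integral_mono_ae (integrable_const _) hint
      (by filter_upwards [h] with x hx using hx.1)
    simpa using this
  have hm2 : m ≤ a + r := by
    have : ∫ x, x j ∂μ ≤ ∫ _, a + r ∂μ := integral_mono_ae hint (integrable_const _)
      (by filter_upwards [h] with x hx using hx.2)
    simpa using this
  have hu : ∀ᵐ x ∂μ, |t * (x j - m)| ≤ 1 := by
    filter_upwards [h] with x hx
    rw [abs_mul]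
    refine (mul_le_mul_of_nonneg_left ?_ (abs_nonneg t)).trans ht
    exact abs_le.2 ⟨by linarith [hx.1], by linarith [hx.2]⟩
  have hexp : ∀ c : ℝ, Integrable (fun x : EuclideanSpace ℝ (Fin d) =>
      Complex.exp ((t * (x j - c) : ℝ) * Complex.I)) μ := fun c => by
    refine Integrable.of_bound (by fun_prop) 1 (Filter.Eventually.of_forall fun x => ?_)
    rw [Complex.norm_exp_ofReal_mul_I]
  have h0 : Integrable (fun x : EuclideanSpace ℝ (Fin d) => t * (x j - m)) μ :=
    (hint.sub (integrable_const m)).const_mul t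
  -- Centring multiplies the characteristic function by a unimodular constant, and the linear term
  -- of a centred variable has integral zero.
  have hshift : ‖coordCharFun μ j t‖ =
      ‖∫ x, (Complex.exp ((t * (x j - m) : ℝ) * Complex.I)
        - (t * (x j - m) : ℝ) * Complex.I) ∂μ‖ := by
    have h0c : Integrable (fun x : EuclideanSpace ℝ (Fin d) =>
        ((t * (x j - m) : ℝ) : ℂ) * Complex.I) μ := h0.ofReal.mul_const _
    rw [integral_sub (hexp m) h0c, integral_mul_const, integral_complex_ofReal,
      integral_const_mul, integral_sub hint (integrable_const m)]
    simp only [integral_const, probReal_univ, smul_eq_mul, one_mul]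
    rw [← hm, sub_self, mul_zero, Complex.ofReal_zero, zero_mul, sub_zero]
    have : ∀ x : EuclideanSpace ℝ (Fin d), Complex.exp ((t * (x j - m) : ℝ) * Complex.I) =
        Complex.exp ((-(t * m) : ℝ) * Complex.I) * Complex.exp ((t * x j : ℝ) * Complex.I) := by
      intro x
      rw [← Complex.exp_add]
      congr 1
      push_cast
      ring
    simp only [this]
    rw [integral_const_mul, norm_mul, Complex.norm_exp_ofReal_mul_I, one_mul]
    rfl
  rw [hshift]
  have hvar : ∫ x, (1 - (t * (x j - m)) ^ 2 / 3) ∂μ =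
      1 - t ^ 2 * variance (fun x => x j) μ / 3 := by
    rw [variance_eq_integral hmeas.aemeasurable, ← hm]
    have hsq : Integrable (fun x : EuclideanSpace ℝ (Fin d) => (x j - m) ^ 2) μ :=
      (hmem.sub (memLp_const m)).integrable_sq
    have : ∀ x : EuclideanSpace ℝ (Fin d), (1 - (t * (x j - m)) ^ 2 / 3) =
        1 - t ^ 2 / 3 * (x j - m) ^ 2 := fun x => by ring
    simp only [this]
    rw [integral_sub (integrable_const _) (hsq.const_mul _), integral_const_mul]
    simp
    ring
  rw [← hvar]
  refine norm_integral_le_of_norm_le ?_ ?_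
  · have hsq : Integrable (fun x : EuclideanSpace ℝ (Fin d) => (t * (x j - m)) ^ 2) μ :=
      ((hmem.sub (memLp_const m)).const_mul t).integrable_sq
    exact (integrable_const _).sub (hsq.div_const 3)
  · filter_upwards [hu] with x hx using norm_exp_mul_I_sub_le hx

lemma norm_coordCharFun_le_one (μ : Measure (EuclideanSpace ℝ (Fin d))) [IsProbabilityMeasure μ]
    (j : Fin d) (t : ℝ) : ‖coordCharFun μ j t‖ ≤ 1 := by
  refine (norm_integral_le_of_norm_le_const (C := 1)
    (Filter.Eventually.of_forall fun x => ?_)).trans (by simp)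
  rw [Complex.norm_exp_ofReal_mul_I]

lemma continuous_coordCharFun (μ : Measure (EuclideanSpace ℝ (Fin d))) [IsProbabilityMeasure μ]
    (j : Fin d) : Continuous (coordCharFun μ j) := by
  refine continuous_of_dominated (bound := fun _ => 1) (fun t => by fun_prop)
    (fun t => Filter.Eventually.of_forall fun x => ?_) (integrable_const _)
    (Filter.Eventually.of_forall fun x => by fun_prop)
  rw [Complex.norm_exp_ofReal_mul_I]

lemma coordCharFun_sumLaw {k : ℕ} {P : Fin k → Measure (EuclideanSpace ℝ (Fin d))}
    [∀ i, IsProbabilityMeasure (P i)] (j : Fin d) (t : ℝ) :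
    coordCharFun (sumLaw P) j t = ∏ i, coordCharFun (P i) j t := by
  rw [coordCharFun, sumLaw, integral_map measurable_sum_vec.aemeasurable (by fun_prop)]
  have : ∀ x : Fin k → EuclideanSpace ℝ (Fin d),
      Complex.exp ((t * (∑ s, x s).ofLp j : ℝ) * Complex.I) =
      ∏ s, Complex.exp ((t * x s j : ℝ) * Complex.I) := by
    intro x
    rw [← Complex.exp_sum]
    congr 1
    simp [Finset.mul_sum, Finset.sum_mul]
  simp only [this]
  exact integral_fintype_prod_eq_prod
    fun _ (y : EuclideanSpace ℝ (Fin d)) => Complex.exp ((t * y j : ℝ) * Complex.I)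

/-- Esseen's concentration inequality. -/
lemma measureReal_coord_near_le (μ : Measure (EuclideanSpace ℝ (Fin d))) [IsProbabilityMeasure μ]
    (j : Fin d) (y : ℝ) {w : ℝ} (hw : 0 < w) :
    μ.real {x | |x j - y| ≤ w} ≤ 2 * ∫ g, ‖coordCharFun μ j (g / w)‖ ∂(gaussianReal 0 1) := by
  have hset : MeasurableSet {x : EuclideanSpace ℝ (Fin d) | |x j - y| ≤ w} :=
    measurableSet_le (by fun_prop) measurable_const
  have hbd : Integrable (fun x : EuclideanSpace ℝ (Fin d) =>
      Real.exp (-((x j - y) / w) ^ 2 / 2)) μ := by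
    refine Integrable.of_bound (by fun_prop) 1 (Filter.Eventually.of_forall fun x => ?_)
    rw [Real.norm_eq_abs, Real.abs_exp]
    exact Real.exp_le_one_iff.2 (by have := sq_nonneg ((x j - y) / w); linarith)
  -- The indicator is dominated by twice a Gaussian, since `2 exp (-1/2) ≥ 1`.
  have h1 : μ.real {x | |x j - y| ≤ w} ≤
      2 * ∫ x, Real.exp (-((x j - y) / w) ^ 2 / 2) ∂μ := by
    rw [← integral_indicator_one hset, ← integral_const_mul]
    refine integral_mono ((integrable_const _).indicator hset) (hbd.const_mul 2) fun x => ?_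
    by_cases hx : |x j - y| ≤ w
    · rw [Set.indicator_of_mem (show x ∈ {z : EuclideanSpace ℝ (Fin d) | |z j - y| ≤ w} from hx)]
      have h2 : ((x j - y) / w) ^ 2 ≤ 1 := by
        rw [sq_le_one_iff_abs_le_one, abs_div, abs_of_pos hw]
        exact (div_le_one hw).2 hx
      have h3 : Real.exp (-(1 / 2)) ≤ Real.exp (-((x j - y) / w) ^ 2 / 2) :=
        Real.exp_le_exp.2 (by linarith)
      have h4 := Real.add_one_le_exp (-(1 / 2) : ℝ)
      simp only [Pi.one_apply]
      linarith
    · rw [Set.indicator_of_notMem (show x ∉ {z : EuclideanSpace ℝ (Fin d) | |z j - y| ≤ w} from hx)]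
      positivity
  refine h1.trans (mul_le_mul_of_nonneg_left ?_ zero_le_two)
  -- The Gaussian is the characteristic function of a Gaussian; Fubini then puts the characteristic
  -- function of `μ` under the integral.
  have hgauss : ∀ u : ℝ, (Real.exp (-u ^ 2 / 2) : ℂ) =
      ∫ g, Complex.exp ((g * u : ℝ) * Complex.I) ∂(gaussianReal 0 1) := by
    intro u
    have := charFun_gaussianReal (μ := 0) (v := 1) u
    rw [charFun_apply_real] at this
    have e : ∀ g : ℝ, Complex.exp ((g * u : ℝ) * Complex.I) =
        Complex.exp (u * g * Complex.I) := fun g => by push_cast; ring_nf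
    simp only [e]
    rw [this]
    push_cast
    congr 1
    simp
    ring
  have hI : Integrable (Function.uncurry fun (x : EuclideanSpace ℝ (Fin d)) (g : ℝ) =>
      Complex.exp ((g * ((x j - y) / w) : ℝ) * Complex.I)) (μ.prod (gaussianReal 0 1)) := by
    refine Integrable.of_bound (C := 1) ?_ (Filter.Eventually.of_forall fun x => ?_)
    · unfold Function.uncurry
      fun_prop
    · rw [Function.uncurry, Complex.norm_exp_ofReal_mul_I]
  have h5 : ((∫ x, Real.exp (-((x j - y) / w) ^ 2 / 2) ∂μ : ℝ) : ℂ) =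
      ∫ g, Complex.exp ((-(g / w * y) : ℝ) * Complex.I) * coordCharFun μ j (g / w)
        ∂(gaussianReal 0 1) := by
    rw [← integral_complex_ofReal]
    simp only [hgauss]
    rw [integral_integral_swap hI]
    refine integral_congr_ae (Filter.Eventually.of_forall fun g => ?_)
    simp only
    rw [coordCharFun, ← integral_const_mul]
    refine integral_congr_ae (Filter.Eventually.of_forall fun x => ?_)
    simp only
    rw [← Complex.exp_add]
    congr 1
    push_cast
    ring
  calc ∫ x, Real.exp (-((x j - y) / w) ^ 2 / 2) ∂μ
      ≤ ‖((∫ x, Real.exp (-((x j - y) / w) ^ 2 / 2) ∂μ : ℝ) : ℂ)‖ := by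
        rw [Complex.norm_real]; exact Real.le_norm_self _
    _ ≤ ∫ g, ‖coordCharFun μ j (g / w)‖ ∂(gaussianReal 0 1) := by
        rw [h5]
        refine (norm_integral_le_integral_norm _).trans (le_of_eq ?_)
        refine integral_congr_ae (Filter.Eventually.of_forall fun g => ?_)
        simp only
        rw [norm_mul, Complex.norm_exp_ofReal_mul_I, one_mul]

lemma integral_exp_neg_mul_sq_gaussianReal_le {β : ℝ} (hβ : 0 < β) :
    ∫ g, Real.exp (-β * g ^ 2) ∂(gaussianReal 0 1) ≤ 1 / √(2 * β) := by
  rw [integral_gaussianReal_eq_integral_smul one_ne_zero]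
  have h1 : ∫ g : ℝ, (√(2 * Real.pi))⁻¹ * Real.exp (-β * g ^ 2) = 1 / √(2 * β) := by
    rw [integral_const_mul, integral_gaussian, ← Real.sqrt_inv,
      ← Real.sqrt_mul (by positivity), one_div, ← Real.sqrt_inv]
    congr 1
    field_simp
  rw [← h1]
  refine integral_mono_of_nonneg (Filter.Eventually.of_forall fun g => ?_)
    ((integrable_exp_neg_mul_sq hβ).const_mul _) (Filter.Eventually.of_forall fun g => ?_)
  · exact mul_nonneg (gaussianPDFReal_nonneg _ _ _) (Real.exp_pos _).le
  · refine mul_le_mul_of_nonneg_right ?_ (Real.exp_pos _).le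
    rw [gaussianPDFReal]
    simp only [NNReal.coe_one, mul_one, sub_zero]
    refine mul_le_of_le_one_right (by positivity) (Real.exp_le_one_iff.2 ?_)
    have := sq_nonneg g
    linarith

/-- Averaging over words turns the product of moduli into the `k`-th power of the mean modulus.
Hence only the mean variance enters, and no control of individual words is needed. -/
lemma sum_prod_integral_coordCharFun_le {k : ℕ} (hk : 0 < k) {κ : Type*} [Fintype κ] (l : κ → ℝ)
    (hl : ∀ c, 0 ≤ l c) (hl1 : ∑ c, l c = 1) (P : κ → Measure (EuclideanSpace ℝ (Fin d)))
    [∀ c, IsProbabilityMeasure (P c)] (j : Fin d) (a : κ → ℝ) {r w v : ℝ} (hr : 0 < r)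
    (hw : 0 < w) (hv : 0 < v)
    (ha : ∀ c, ∀ᵐ x ∂P c, x j ∈ Set.Icc (a c) (a c + r))
    (hvar : v * r ^ 2 ≤ ∑ c, l c * variance (fun x => x j) (P c)) :
    ∑ c : Fin k → κ, (∏ i, l (c i)) *
      ∫ g, ‖coordCharFun (sumLaw fun i => P (c i)) j (g / (w * r))‖ ∂(gaussianReal 0 1) ≤
      2 * w / √(k * v) + 1 / w ^ 2 := by
  classical
  have hk' : (0 : ℝ) < k := by exact_mod_cast hk
  set β := k * v / (3 * w ^ 2) with hβ
  have hβ0 : 0 < β := by positivity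
  have hφ : ∀ g : ℝ, ∑ c : Fin k → κ, (∏ i, l (c i)) *
      ‖coordCharFun (sumLaw fun i => P (c i)) j (g / (w * r))‖ =
      (∑ c, l c * ‖coordCharFun (P c) j (g / (w * r))‖) ^ k := by
    intro g
    have := Finset.prod_univ_sum (fun _ : Fin k => (Finset.univ : Finset κ))
      (fun _ c => l c * ‖coordCharFun (P c) j (g / (w * r))‖)
    rw [Fintype.piFinset_univ, Finset.prod_const, Finset.card_univ, Fintype.card_fin] at this
    rw [this]
    refine Finset.sum_congr rfl fun c _ => ?_
    rw [coordCharFun_sumLaw, norm_prod, Finset.prod_mul_distrib]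
  have hint : ∀ c : Fin k → κ, Integrable (fun g : ℝ =>
      ‖coordCharFun (sumLaw fun i => P (c i)) j (g / (w * r))‖) (gaussianReal 0 1) := fun c => by
    refine Integrable.of_bound (C := 1) ?_ (Filter.Eventually.of_forall fun g => ?_)
    · exact ((continuous_coordCharFun _ j).comp (by fun_prop)).norm.aestronglyMeasurable
    · rw [norm_norm]; exact norm_coordCharFun_le_one _ j _
  simp only [← integral_const_mul]
  rw [← integral_finsetSum _ fun c _ => (hint c).const_mul _]
  simp only [hφ]
  have hsq : Integrable (fun g : ℝ => g ^ 2 / w ^ 2) (gaussianReal 0 1) :=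
    ((memLp_id_gaussianReal 2).integrable_sq).div_const _
  have hexp : Integrable (fun g : ℝ => Real.exp (-β * g ^ 2)) (gaussianReal 0 1) := by
    refine Integrable.of_bound (C := 1) (by fun_prop) (Filter.Eventually.of_forall fun g => ?_)
    rw [Real.norm_eq_abs, Real.abs_exp]
    exact Real.exp_le_one_iff.2 (by nlinarith [sq_nonneg g])
  have hnn : ∀ g : ℝ, 0 ≤ ∑ c, l c * ‖coordCharFun (P c) j (g / (w * r))‖ := fun g =>
    Finset.sum_nonneg fun c _ => mul_nonneg (hl c) (norm_nonneg _)
  have hpt : ∀ g : ℝ, (∑ c, l c * ‖coordCharFun (P c) j (g / (w * r))‖) ^ k ≤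
      Real.exp (-β * g ^ 2) + g ^ 2 / w ^ 2 := by
    intro g
    -- For `|g| ≤ w` the quadratic bound applies to every component and gives Gaussian decay. For
    -- `|g| > w` the trivial bound `1 ≤ g^2 / w^2` is used, and the second moment of `g` yields the
    -- term `1 / w^2`.
    rcases le_or_gt |g| w with hg | hg
    · have h1 : ∑ c, l c * ‖coordCharFun (P c) j (g / (w * r))‖ ≤
          1 - v * (g / w) ^ 2 / 3 := by
        calc _ ≤ ∑ c, l c * (1 - (g / (w * r)) ^ 2 * variance (fun x => x j) (P c) / 3) := by
              refine Finset.sum_le_sum fun c _ => mul_le_mul_of_nonneg_left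
                (norm_coordCharFun_le (ha c) ?_) (hl c)
              rw [abs_div, abs_of_pos (by positivity : 0 < w * r)]
              rw [div_mul_eq_mul_div, div_le_one (by positivity)]
              exact mul_le_mul_of_nonneg_right hg hr.le
          _ = 1 - (g / (w * r)) ^ 2 / 3 * ∑ c, l c * variance (fun x => x j) (P c) := by
              simp only [mul_sub, mul_one]
              rw [Finset.sum_sub_distrib, hl1, Finset.mul_sum]
              exact congrArg _ (Finset.sum_congr rfl fun c _ => by ring)
          _ ≤ 1 - (g / (w * r)) ^ 2 / 3 * (v * r ^ 2) := by gcongr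
          _ = _ := by field_simp
      have h2 : 1 - v * (g / w) ^ 2 / 3 ≤ Real.exp (-(v * (g / w) ^ 2 / 3)) := by
        have := Real.add_one_le_exp (-(v * (g / w) ^ 2 / 3))
        linarith
      have h3 := pow_le_pow_left₀ (hnn g) (h1.trans h2) k
      rw [← Real.exp_nat_mul] at h3
      have h4 : (k : ℝ) * -(v * (g / w) ^ 2 / 3) = -β * g ^ 2 := by
        rw [hβ]; field_simp
      rw [h4] at h3
      have : 0 ≤ g ^ 2 / w ^ 2 := by positivity
      linarith
    · have h1 : ∑ c, l c * ‖coordCharFun (P c) j (g / (w * r))‖ ≤ 1 := by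
        rw [← hl1]
        exact Finset.sum_le_sum fun c _ => mul_le_of_le_one_right (hl c)
          (norm_coordCharFun_le_one _ _ _)
      have h2 := pow_le_one₀ (n := k) (hnn g) h1
      have h3 : 1 ≤ g ^ 2 / w ^ 2 := by
        rw [one_le_div (by positivity), ← sq_abs g]
        exact pow_le_pow_left₀ hw.le hg.le 2
      have := Real.exp_pos (-β * g ^ 2)
      linarith
  refine (integral_mono_of_nonneg (Filter.Eventually.of_forall fun g => pow_nonneg (hnn g) k)
    (hexp.add hsq) (Filter.Eventually.of_forall hpt)).trans ?_
  rw [integral_add' hexp hsq]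
  refine add_le_add ((integral_exp_neg_mul_sq_gaussianReal_le hβ0).trans ?_) (le_of_eq ?_)
  · have h1 : √(k * v) / (2 * w) ≤ √(2 * β) := by
      rw [div_le_iff₀ (by positivity)]
      refine Real.sqrt_le_iff.2 ⟨by positivity, ?_⟩
      rw [mul_pow, Real.sq_sqrt (by positivity), hβ]
      have : 2 * (k * v / (3 * w ^ 2)) * (2 * w) ^ 2 = 8 / 3 * (k * v) := by field_simp; ring
      rw [this]
      nlinarith [mul_pos hk' hv]
    have h2 : 0 < √(k * v) / (2 * w) := by
      have : 0 < √(k * v) := Real.sqrt_pos.2 (by positivity)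
      positivity
    calc 1 / √(2 * β) ≤ 1 / (√(k * v) / (2 * w)) := one_div_le_one_div_of_le h2 h1
      _ = 2 * w / √(k * v) := one_div_div _ _
  · rw [integral_div]
    congr 1
    have := variance_fun_id_gaussianReal (μ := 0) (v := 1)
    rw [variance_eq_integral measurable_id'.aemeasurable] at this
    simpa using this

/-! ### Lower bound for the entropy along tubes -/

/-- The bound `-log b` replaced by its tangent at a free parameter `t`: being affine in `b`, it can
be averaged over words with one common `t`. -/
lemma le_mapEntropy_of_measureReal_le {X ι : Type*} [MeasurableSpace X] {μ : Measure X}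
    [IsProbabilityMeasure μ] {F : X → ι} (hF : ∀ i, MeasurableSet (F ⁻¹' {i})) {T : Finset ι}
    (hT : ∀ᵐ x ∂μ, F x ∈ T) {b t : ℝ} (ht : 0 < t) (hb : ∀ i, μ.real (F ⁻¹' {i}) ≤ b) :
    -Real.log t + 1 - b / t ≤ mapEntropy μ F := by
  have h : -Real.log t + 1 - b / t = ∑ i ∈ T, μ.real (F ⁻¹' {i}) * (-Real.log t + 1 - b / t) := by
    rw [← Finset.sum_mul, sum_measureReal_fiber hF hT, one_mul]
  rw [mapEntropy_eq_sum hT, h]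
  refine Finset.sum_le_sum fun i _ => ?_
  rcases (measureReal_nonneg (μ := μ) (s := F ⁻¹' {i})).eq_or_lt with h0 | h0
  · simp [← h0]
  rw [Real.negMulLog, neg_mul, ← mul_neg]
  refine mul_le_mul_of_nonneg_left ?_ h0.le
  have h1 := log_le_tangent h0 ht
  have h2 : μ.real (F ⁻¹' {i}) / t ≤ b / t := by have := hb i; gcongr
  linarith

lemma two_zpow_sq (N : ℤ) : ((2 : ℝ) ^ N) ^ 2 = 4 ^ N := by
  rw [← zpow_natCast, zpow_comm]; norm_num

lemma four_zpow_mul_two_zpow_neg_sq (N : ℤ) : (4 : ℝ) ^ N * ((2 : ℝ) ^ (-N)) ^ 2 = 1 := by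
  rw [two_zpow_sq, ← zpow_add₀ (by norm_num), add_neg_cancel, zpow_zero]

lemma coordIndex_eq_imp_mem_Icc {N : ℤ} {j : Fin d} {x : EuclideanSpace ℝ (Fin d)} {i : ℤ}
    (h : coordIndex N j x = i) : x j ∈ Set.Icc (i * 2 ^ (-N) : ℝ) (i * 2 ^ (-N) + 2 ^ (-N)) := by
  have h1 := Int.floor_eq_iff.1 h
  have hA : (0 : ℝ) < 2 ^ N := by positivity
  have hi : (0 : ℝ) < ((2 : ℝ) ^ N)⁻¹ := by positivity
  have h2 := mul_le_mul_of_nonneg_right h1.1 hi.le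
  have h3 := mul_le_mul_of_nonneg_right h1.2.le hi.le
  have h4 : (2 : ℝ) ^ N * x j * ((2 : ℝ) ^ N)⁻¹ = x j := by field_simp
  rw [h4] at h2 h3
  rw [zpow_neg]
  constructor <;> linarith

lemma measureReal_coordIndex_le (μ : Measure (EuclideanSpace ℝ (Fin d))) [IsProbabilityMeasure μ]
    (j : Fin d) (A : ℤ) (i : ℤ) :
    μ.real (coordIndex A j ⁻¹' {i}) ≤
      2 * ∫ g, ‖coordCharFun μ j (g / 2 ^ (-A))‖ ∂(gaussianReal 0 1) := by
  refine le_trans (measureReal_mono fun x (hx : ⌊(2 : ℝ) ^ A * x j⌋ = i) => ?_)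
    (measureReal_coord_near_le μ j (i * 2 ^ (-A)) (by positivity : (0 : ℝ) < 2 ^ (-A)))
  have h := coordIndex_eq_imp_mem_Icc hx
  have hA : (0 : ℝ) < 2 ^ (-A) := by positivity
  change |x j - i * 2 ^ (-A)| ≤ 2 ^ (-A)
  exact abs_le.2 ⟨by linarith [h.1], by linarith [h.2]⟩

lemma isBoundedMeasure_of_box {μ : Measure (EuclideanSpace ℝ (Fin d))} {a b : Fin d → ℝ}
    (h : ∀ i, ∀ᵐ x ∂μ, x i ∈ Set.Icc (a i) (b i)) : IsBoundedMeasure μ := by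
  refine ⟨√(∑ i, (max |a i| |b i|) ^ 2), ?_⟩
  filter_upwards [ae_all_iff.2 h] with x hx
  rw [EuclideanSpace.norm_eq]
  refine Real.sqrt_le_sqrt (Finset.sum_le_sum fun i _ => pow_le_pow_left₀ (norm_nonneg _) ?_ 2)
  exact abs_le_max_abs_abs (hx i).1 (hx i).2

/-- If the components of `θ` in boxes of levels `N` have nontrivial variance in direction `j` on
average, then the self-convolution has almost full entropy along tubes in direction `j`. -/
lemma tube_entropy_lower_bound {κ : Type*} [Fintype κ] {θ : Measure (EuclideanSpace ℝ (Fin d))}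
    [IsProbabilityMeasure θ] (l : κ → ℝ) (hl : ∀ c, 0 ≤ l c) (hl1 : ∑ c, l c = 1)
    (P : κ → Measure (EuclideanSpace ℝ (Fin d))) [∀ c, IsProbabilityMeasure (P c)]
    (hθ : θ = ∑ c, ENNReal.ofReal (l c) • P c) (hθb : IsBoundedMeasure θ)
    (N : Fin d → ℤ) (a : κ → Fin d → ℝ)
    (ha : ∀ c i, ∀ᵐ x ∂P c, x i ∈ Set.Icc (a c i) (a c i + 2 ^ (-N i)))
    (j : Fin d) {v : ℝ} (hv : 0 < v) (hv1 : v ≤ 1)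
    (hvar : v ≤ ∑ c, l c * (4 ^ N j * variance (fun x => x j) (P c)))
    {A' A : Fin d → ℤ} (hA : A' ≤ A) {k : ℕ} (hk : 0 < k) {B : ℝ}
    (hBj : (k : ℝ) * 4 ^ (A' j - N j) ≤ B)
    (hB : ∀ i ≠ j, (k : ℝ) * 4 ^ (A i - N i) ≤ B)
    (hw : √k ≤ ((2 : ℝ) ^ (N j - A j)) ^ 3) :
    -Real.log (6 * 2 ^ (N j - A j) / √(k * v)) - d * (entropyConst + Real.log (1 + B)) ≤
      mapEntropy (selfConv θ k) (boxIndex A) -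
        mapEntropy (selfConv θ k) (boxIndex (tubeLevel A' A j)) := by
  classical
  have hk' : (0 : ℝ) < k := by exact_mod_cast hk
  have hPb : ∀ c, IsBoundedMeasure (P c) := fun c => isBoundedMeasure_of_box (ha c)
  set Q : (Fin k → κ) → Measure (EuclideanSpace ℝ (Fin d)) :=
    fun c => sumLaw fun i => P (c i) with hQ
  have hQp : ∀ c, IsProbabilityMeasure (Q c) := fun c => by rw [hQ]; infer_instance
  have hQb : ∀ c, IsBoundedMeasure (Q c) := fun c => isBoundedMeasure_sumLaw fun i => hPb (c i)
  set Λ : (Fin k → κ) → ℝ := fun c => ∏ i, l (c i) with hΛ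
  have hΛ0 : ∀ c, 0 ≤ Λ c := fun c => Finset.prod_nonneg fun i _ => hl _
  have hΛ1 : ∑ c, Λ c = 1 := by
    have := Finset.prod_univ_sum (fun _ : Fin k => (Finset.univ : Finset κ)) (fun _ c => l c)
    rw [Fintype.piFinset_univ, hl1, Finset.prod_const_one] at this
    exact this.symm
  have : IsProbabilityMeasure (selfConv θ k) := by rw [selfConv_eq_sumLaw]; infer_instance
  have hconc := mapEntropy_box_sub_concave (ν := selfConv θ k)
    (isBoundedMeasure_sumLaw fun _ => hθb) Λ Q hQb hΛ0
    (fun s hs => selfConv_real_eq_sum l hl P hθ hs) (tubeLevel_le hA j)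
  refine le_trans ?_ hconc
  have hvarQ : ∀ c i, 4 ^ N i * variance (fun x => x i) (Q c) ≤ k := by
    intro c i
    rw [hQ, variance_sumLaw (fun s => hPb (c s)), Finset.mul_sum]
    calc _ ≤ ∑ _s : Fin k, (1 : ℝ) := by
          refine Finset.sum_le_sum fun s _ => ?_
          have h1 := variance_le_sq_of_bounded (ha (c s) i) (by fun_prop)
          have h2 : (4 : ℝ) ^ N i * ((2 : ℝ) ^ (-N i)) ^ 2 = 1 :=
            four_zpow_mul_two_zpow_neg_sq _
          have h3 : (0 : ℝ) < 4 ^ N i := by positivity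
          have h4 := mul_le_mul_of_nonneg_left h1 h3.le
          rw [add_sub_cancel_left, div_pow] at h4
          linarith
      _ = k := by simp
  have hB0 : 0 ≤ B := le_trans (by positivity) hBj
  -- At the tube levels every coordinate of the sum has rescaled variance at most `B`, so
  -- subadditivity bounds the whole tube entropy.
  have hup : ∀ c, mapEntropy (Q c) (boxIndex (tubeLevel A' A j)) ≤
      d * (entropyConst + Real.log (1 + B)) := by
    intro c
    refine (mapEntropy_box_le_sum (hQb c) _).trans ?_
    have : (d : ℝ) * (entropyConst + Real.log (1 + B)) =
        ∑ _i : Fin d, (entropyConst + Real.log (1 + B)) := by simp [mul_add]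
    rw [this]
    refine Finset.sum_le_sum fun i _ => (mapEntropy_coord_le_log (hQb c) _ i).trans ?_
    have hvn := variance_nonneg (fun x : EuclideanSpace ℝ (Fin d) => x i) (Q c)
    have key : ∀ M : ℤ, (k : ℝ) * 4 ^ (M - N i) ≤ B →
        (4 : ℝ) ^ M * variance (fun x => x i) (Q c) ≤ B := fun M hM => by
      refine le_trans ?_ hM
      have h1 := mul_le_mul_of_nonneg_right (hvarQ c i)
        (by positivity : (0 : ℝ) ≤ 4 ^ (M - N i))
      have h2 : (4 : ℝ) ^ N i * variance (fun x => x i) (Q c) * 4 ^ (M - N i) =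
          4 ^ M * variance (fun x => x i) (Q c) := by
        rw [zpow_sub₀ (by norm_num)]
        have : (4 : ℝ) ^ N i ≠ 0 := by positivity
        field_simp
      linarith
    have h5 : (4 : ℝ) ^ (tubeLevel A' A j i) * variance (fun x => x i) (Q c) ≤ B := by
      by_cases hi : i = j
      · subst hi; simpa [tubeLevel] using key _ hBj
      · simpa [tubeLevel, hi] using key _ (hB i hi)
    gcongr
  set w : ℝ := 2 ^ (N j - A j) with hwdef
  have hw0 : 0 < w := by positivity
  -- Upper bound for the mean of `b`: a factor `2` from Esseen's inequality times `2 + 1`, where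
  -- `hw` absorbs the tail `1 / w^2` into `w / √(k v)`. Here `w` is the cell width at level `A j` in
  -- units of the component width.
  set t : ℝ := 6 * w / √(k * v) with htdef
  have hsq0 : 0 < √(k * v) := Real.sqrt_pos.2 (by positivity)
  have ht : 0 < t := by positivity
  set b : (Fin k → κ) → ℝ := fun c =>
    2 * ∫ g, ‖coordCharFun (Q c) j (g / 2 ^ (-A j))‖ ∂(gaussianReal 0 1) with hb
  have hlow : ∀ c, -Real.log t + 1 - b c / t ≤ mapEntropy (Q c) (boxIndex A) := by
    intro c
    obtain ⟨T, hT⟩ := (hQb c).exists_finset A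
    have hT' : ∀ᵐ x ∂Q c, coordIndex (A j) j x ∈ T.image fun i => i j := by
      filter_upwards [hT] with x hx
      exact Finset.mem_image.2 ⟨_, hx, rfl⟩
    exact (le_mapEntropy_of_measureReal_le
      (fun i => measurable_coordIndex (A j) j (measurableSet_singleton i)) hT' ht
      (measureReal_coordIndex_le (Q c) j (A j))).trans (mapEntropy_coord_le (hQb c) A j)
  have hbsum : ∑ c, Λ c * b c ≤ t := by
    have h1 := sum_prod_integral_coordCharFun_le hk l hl hl1 P j (fun c => a c j)
      (r := 2 ^ (-N j)) (w := w) (v := v) (by positivity) hw0 hv (fun c => ha c j) (by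
        have h2 : (4 : ℝ) ^ N j * ((2 : ℝ) ^ (-N j)) ^ 2 = 1 :=
            four_zpow_mul_two_zpow_neg_sq _
        have h3 := mul_le_mul_of_nonneg_right hvar (sq_nonneg ((2 : ℝ) ^ (-N j)))
        refine h3.trans (le_of_eq ?_)
        rw [Finset.sum_mul]
        refine Finset.sum_congr rfl fun c _ => ?_
        calc _ = l c * variance (fun x => x j) (P c) * (4 ^ N j * ((2 : ℝ) ^ (-N j)) ^ 2) := by
              ring
          _ = _ := by rw [h2, mul_one])
    have hwr : w * (2 : ℝ) ^ (-N j) = 2 ^ (-A j) := by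
      rw [hwdef, ← zpow_add₀ two_ne_zero]; congr 1; ring
    rw [hwr] at h1
    have h2 : 1 / w ^ 2 ≤ w / √(k * v) := by
      rw [div_le_div_iff₀ (by positivity) hsq0, one_mul]
      calc √(k * v) ≤ √k := Real.sqrt_le_sqrt (mul_le_of_le_one_right hk'.le hv1)
        _ ≤ w ^ 3 := hw
        _ = w * w ^ 2 := by ring
    calc ∑ c, Λ c * b c = 2 * ∑ c : Fin k → κ, (∏ i, l (c i)) *
          ∫ g, ‖coordCharFun (sumLaw fun i => P (c i)) j (g / 2 ^ (-A j))‖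
            ∂(gaussianReal 0 1) := by
          rw [Finset.mul_sum]
          exact Finset.sum_congr rfl fun c _ => by rw [hΛ, hb]; ring
      _ ≤ 2 * (2 * w / √(k * v) + w / √(k * v)) := by gcongr; exact h1.trans (by gcongr)
      _ = t := by rw [htdef]; ring
  calc -Real.log t - d * (entropyConst + Real.log (1 + B))
      ≤ (-Real.log t + 1 - (∑ c, Λ c * b c) / t) - d * (entropyConst + Real.log (1 + B)) := by
        have := (div_le_one ht).2 hbsum
        linarith
    _ = ∑ c, Λ c * ((-Real.log t + 1 - b c / t) - d * (entropyConst + Real.log (1 + B))) := by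
        simp only [mul_sub, Finset.sum_sub_distrib, ← Finset.sum_mul, hΛ1, one_mul,
          mul_div_assoc', ← Finset.sum_div]
    _ ≤ ∑ c, Λ c * (mapEntropy (Q c) (boxIndex A) -
          mapEntropy (Q c) (boxIndex (tubeLevel A' A j))) := by
        refine Finset.sum_le_sum fun c _ => mul_le_mul_of_nonneg_left ?_ (hΛ0 c)
        exact sub_le_sub (hlow c) (hup c)

/-! ### Entropy increments and the variance of components -/

/-- `θ` is a finite mixture of probability measures on boxes of levels `N` whose rescaled variance
in direction `j` is at least `v` on average. -/
def HasVariance (θ : Measure (EuclideanSpace ℝ (Fin d))) (N : Fin d → ℤ) (j : Fin d) (v : ℝ) :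
    Prop :=
  ∃ (κ : Type) (_ : Fintype κ) (l : κ → ℝ) (P : κ → Measure (EuclideanSpace ℝ (Fin d)))
    (a : κ → Fin d → ℝ), (∀ c, 0 ≤ l c) ∧ ∑ c, l c = 1 ∧ (∀ c, IsProbabilityMeasure (P c)) ∧
    θ = ∑ c, ENNReal.ofReal (l c) • P c ∧
    (∀ c i, ∀ᵐ x ∂P c, x i ∈ Set.Icc (a c i) (a c i + 2 ^ (-N i))) ∧
    v ≤ ∑ c, l c * (4 ^ N j * variance (fun x => x j) (P c))

/-- The entropy increment between two box partitions is controlled by the rescaled variances of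
the components in the coarser boxes. -/
lemma exists_variance_of_entropy_increment {θ : Measure (EuclideanSpace ℝ (Fin d))}
    [IsProbabilityMeasure θ] (hθ : IsBoundedMeasure θ) {N N' : Fin d → ℤ} (hN : N ≤ N') :
    ∃ v : Fin d → ℝ, (∀ j, 0 ≤ v j) ∧ (∀ j, v j ≤ 1) ∧
      mapEntropy θ (boxIndex N') - mapEntropy θ (boxIndex N) ≤
        ∑ j, (entropyConst + 4 ^ (N' j - N j) * v j) ∧
      ∀ j, HasVariance θ N j (v j) := by
  classical
  obtain ⟨T, hT⟩ := hθ.exists_finset N'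
  have hdiff := sum_mul_mapEntropy_cond (measurableSet_boxIndex_fiber N') hT (coarsen N N')
    (by rw [coarsen_comp_boxIndex hN]; exact measurableSet_boxIndex_fiber N)
  rw [coarsen_comp_boxIndex hN] at hdiff
  have hTN : ∀ᵐ x ∂θ, boxIndex N x ∈ T.image (coarsen N N') := by
    filter_upwards [hT] with x hx
    rw [← coarsen_comp_boxIndex hN]
    exact Finset.mem_image_of_mem _ hx
  -- Null cells are discarded so that every conditional measure is a probability measure.
  set S := (T.image (coarsen N N')).filter fun c => θ.real (boxIndex N ⁻¹' {c}) ≠ 0 with hS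
  have hSne : ∀ c : S, θ (boxIndex N ⁻¹' {c.1}) ≠ 0 := fun c h0 =>
    (Finset.mem_filter.1 c.2).2 (by simp [Measure.real, h0])
  have hsum : ∀ F : (Fin d → ℤ) → ℝ,
      ∑ c ∈ T.image (coarsen N N'), θ.real (boxIndex N ⁻¹' {c}) * F c =
      ∑ c : S, θ.real (boxIndex N ⁻¹' {c.1}) * F c.1 := by
    intro F
    rw [Finset.sum_coe_sort S fun c => θ.real (boxIndex N ⁻¹' {c}) * F c, hS,
      Finset.sum_filter_of_ne]
    intro c _ hc h0
    simp [h0] at hc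
  set l : S → ℝ := fun c => θ.real (boxIndex N ⁻¹' {c.1}) with hl
  set P : S → Measure (EuclideanSpace ℝ (Fin d)) := fun c => cond θ (boxIndex N ⁻¹' {c.1}) with hP
  have hl0 : ∀ c, 0 ≤ l c := fun c => measureReal_nonneg
  have hl1 : ∑ c, l c = 1 := by
    have h1 := sum_measureReal_fiber (measurableSet_boxIndex_fiber N) hTN
    have h2 := hsum fun _ => 1
    simp only [mul_one] at h2
    rw [← h1, h2]
  have hPp : ∀ c, IsProbabilityMeasure (P c) := fun c => cond_isProbabilityMeasure (hSne c)
  have hbox : ∀ c i, ∀ᵐ x ∂P c, x i ∈ Set.Icc ((c.1 i : ℝ) * 2 ^ (-N i))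
      ((c.1 i : ℝ) * 2 ^ (-N i) + 2 ^ (-N i)) := by
    intro c i
    filter_upwards [ae_cond_mem (μ := θ) (measurableSet_boxIndex_fiber N c.1)] with x hx
    exact coordIndex_eq_imp_mem_Icc (congrFun (show boxIndex N x = c.1 from hx) i)
  have hPb : ∀ c, IsBoundedMeasure (P c) := fun c => isBoundedMeasure_of_box (hbox c)
  have hmix : θ = ∑ c, ENNReal.ofReal (l c) • P c := by
    refine Measure.ext fun s hs => ?_
    rw [Measure.finsetSum_apply]
    have h1 : ∀ c : S, (ENNReal.ofReal (l c) • P c) s = θ (boxIndex N ⁻¹' {c.1} ∩ s) := by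
      intro c
      rw [Measure.smul_apply, smul_eq_mul, hl, hP, ofReal_measureReal, mul_comm,
        cond_mul_eq_inter (measurableSet_boxIndex_fiber N c.1)]
    simp only [h1]
    rw [Finset.sum_coe_sort S fun c => θ (boxIndex N ⁻¹' {c} ∩ s),
      ← measure_biUnion_finset]
    · refine measure_congr ?_
      have h2 : ∀ᵐ x ∂θ, boxIndex N x ∈ S := by
        have h3 : ∀ c ∈ T.image (coarsen N N'), c ∉ S → ∀ᵐ x ∂θ, boxIndex N x ≠ c := by
          intro c hc hcS
          have h4 : θ.real (boxIndex N ⁻¹' {c}) = 0 := by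
            by_contra h0
            exact hcS (Finset.mem_filter.2 ⟨hc, h0⟩)
          rw [measureReal_eq_zero_iff] at h4
          have h5 : {x | ¬ boxIndex N x ≠ c} = boxIndex N ⁻¹' {c} := by ext; simp
          rwa [ae_iff, h5]
        have h5 : ∀ᵐ x ∂θ, ∀ c ∈ T.image (coarsen N N'), c ∉ S → boxIndex N x ≠ c := by
          rw [Finset.eventually_all]
          intro c hc
          by_cases hcS : c ∈ S
          · exact Filter.Eventually.of_forall fun x h => absurd hcS h
          · filter_upwards [h3 c hc hcS] with x hx _ using hx
        filter_upwards [h5, hTN] with x hx hxT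
        by_contra hxS
        exact hx _ hxT hxS rfl
      filter_upwards [h2] with x hx
      change (x ∈ s) = (x ∈ (⋃ c ∈ S, boxIndex N ⁻¹' {c} ∩ s : Set _))
      simp [hx]
    · intro c _ c' _ hcc
      exact Set.disjoint_left.2 fun x hx hx' => hcc (hx.1.symm.trans hx'.1)
    · exact fun c _ => (measurableSet_boxIndex_fiber N c).inter hs
  refine ⟨fun j => ∑ c, l c * (4 ^ N j * variance (fun x => x j) (P c)), fun j => ?_, fun j => ?_,
    ?_, fun j => ⟨S, inferInstance, l, P, fun c i => (c.1 i : ℝ) * 2 ^ (-N i), hl0, hl1, hPp,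
      hmix, hbox, le_rfl⟩⟩
  · exact Finset.sum_nonneg fun c _ => mul_nonneg (hl0 c)
      (mul_nonneg (by positivity) (variance_nonneg _ _))
  · rw [← hl1]
    refine Finset.sum_le_sum fun c _ => mul_le_of_le_one_right (hl0 c) ?_
    have h1 := variance_le_sq_of_bounded (hbox c j) (by fun_prop)
    have h3 : (0 : ℝ) < 4 ^ N j := by positivity
    have h4 := mul_le_mul_of_nonneg_left h1 h3.le
    rw [add_sub_cancel_left, div_pow] at h4
    have := four_zpow_mul_two_zpow_neg_sq (N j)
    linarith
  · rw [← hdiff, hsum fun c => mapEntropy (cond θ (boxIndex N ⁻¹' {c})) (boxIndex N')]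
    calc _ ≤ ∑ c, l c * ∑ j, (entropyConst + 4 ^ N' j * variance (fun x => x j) (P c)) := by
          refine Finset.sum_le_sum fun c _ => mul_le_mul_of_nonneg_left
            ((mapEntropy_box_le_sum (hPb c) N').trans (Finset.sum_le_sum fun j _ =>
              (mapEntropy_coord_le_log (hPb c) (N' j) j).trans ?_)) (hl0 c)
          have h1 : (0 : ℝ) ≤ 4 ^ N' j * variance (fun x => x j) (P c) :=
            mul_nonneg (by positivity) (variance_nonneg _ _)
          -- Linearising `log (1 + x) ≤ x` makes the bound linear in the variance, so that it
          -- averages over components.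
          have := Real.log_le_sub_one_of_pos (by linarith :
            (0 : ℝ) < 1 + 4 ^ N' j * variance (fun x => x j) (P c))
          linarith
      _ = ∑ j, ∑ c, (l c * entropyConst +
            4 ^ (N' j - N j) * (l c * (4 ^ N j * variance (fun x => x j) (P c)))) := by
          rw [Finset.sum_comm]
          refine Finset.sum_congr rfl fun c _ => ?_
          rw [Finset.mul_sum]
          refine Finset.sum_congr rfl fun j _ => ?_
          rw [zpow_sub₀ (by norm_num)]
          have : (4 : ℝ) ^ N j ≠ 0 := by positivity
          field_simp
      _ = _ := by
          refine Finset.sum_congr rfl fun j _ => ?_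
          rw [Finset.sum_add_distrib, ← Finset.sum_mul, hl1, one_mul, Finset.mul_sum]

/-! ### Averaging over scales -/

/-- In the sum of overlapping increments all but the first and last `M` values cancel; monotonicity
compares these with `G M` and `G n`. -/
lemma mul_sub_le_sum_range_shift {G : ℕ → ℝ} (hG : Monotone G) (n M : ℕ) :
    M * (G n - G M) ≤ ∑ q ∈ Finset.range n, (G (q + M) - G q) := by
  have h1 : ∑ q ∈ Finset.range n, G q + ∑ q ∈ Finset.range M, G (n + q) =
      ∑ q ∈ Finset.range M, G q + ∑ q ∈ Finset.range n, G (M + q) := by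
    rw [← Finset.sum_range_add, ← Finset.sum_range_add, add_comm n M]
  have h2 : (M : ℝ) * G n ≤ ∑ q ∈ Finset.range M, G (n + q) := by
    have := Finset.card_nsmul_le_sum (Finset.range M) (fun q => G (n + q)) (G n)
      fun q _ => hG (by omega)
    simpa using this
  have h3 : ∑ q ∈ Finset.range M, G q ≤ M * G M := by
    have := Finset.sum_le_card_nsmul (Finset.range M) G (G M)
      fun q hq => hG (Finset.mem_range.1 hq).le
    simpa using this
  rw [Finset.sum_sub_distrib]
  simp only [add_comm _ M]
  linarith

/-- Pigeonhole over the `d` directions, then reverse Markov: half of the mean `c / d` may come from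
small values, the rest needs many large ones because `v ≤ 1`. -/
lemma exists_many_large (hd : 0 < d) {n : ℕ} {v : ℕ → Fin d → ℝ} (hv : ∀ q j, v q j ≤ 1)
    {c : ℝ} (hc : 0 ≤ c) (h : n * c ≤ ∑ q ∈ Finset.range n, ∑ j, v q j) :
    ∃ j, n * (c / (2 * d)) ≤
      ((Finset.range n).filter fun q => c / (2 * d) ≤ v q j).card := by
  have : Nonempty (Fin d) := ⟨⟨0, hd⟩⟩
  have hd' : (0 : ℝ) < d := by exact_mod_cast hd
  rw [Finset.sum_comm] at h
  obtain ⟨j, -, hj⟩ := Finset.exists_le_of_sum_le (s := Finset.univ)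
    (f := fun _ : Fin d => n * c / d) (g := fun j => ∑ q ∈ Finset.range n, v q j)
    Finset.univ_nonempty (by
      refine le_trans (le_of_eq ?_) h
      rw [Finset.sum_const, Finset.card_univ, Fintype.card_fin, nsmul_eq_mul]
      field_simp)
  refine ⟨j, ?_⟩
  have h1 : ∑ q ∈ Finset.range n, v q j ≤
      ∑ q ∈ Finset.range n, ((if c / (2 * d) ≤ v q j then 1 else 0) + c / (2 * d)) := by
    refine Finset.sum_le_sum fun q _ => ?_
    have : 0 ≤ c / (2 * d) := by positivity
    split_ifs with hq
    · linarith [hv q j]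
    · linarith
  rw [Finset.sum_add_distrib, Finset.sum_boole, Finset.sum_const, Finset.card_range,
    nsmul_eq_mul] at h1
  have h2 : (n : ℝ) * c / d = n * (c / (2 * d)) + n * (c / (2 * d)) := by field_simp; ring
  linarith

/-! ### Offset partitions and scales of nontrivial variance -/

/-- Levels of a box partition with offset `L i` in coordinate `i`. -/
noncomputable def offsetLevel (χ : Fin d → ℝ) (L : Fin d → ℕ) (q : ℕ) : Fin d → ℤ :=
  fun i => ⌊χ i * ((q : ℝ) + L i)⌋

lemma offsetLevel_mono {χ : Fin d → ℝ} (hχ : ∀ j, 0 < χ j) (L : Fin d → ℕ) :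
    Monotone (offsetLevel χ L) := fun a b hab j =>
  Int.floor_le_floor (mul_le_mul_of_nonneg_left
    (by have : (a : ℝ) ≤ b := by exact_mod_cast hab
        linarith) (hχ j).le)

lemma level_le_offsetLevel {χ : Fin d → ℝ} (hχ : ∀ j, 0 < χ j) (L : Fin d → ℕ) (q : ℕ) :
    level χ q ≤ offsetLevel χ L q := fun j =>
  Int.floor_le_floor (mul_le_mul_of_nonneg_left (by simp) (hχ j).le)

lemma HasVariance.mono {θ : Measure (EuclideanSpace ℝ (Fin d))} {N : Fin d → ℤ} {j : Fin d}
    {u v : ℝ} (h : HasVariance θ N j v) (huv : u ≤ v) : HasVariance θ N j u := by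
  obtain ⟨κ, hκ, l, P, a, h1, h2, h3, h4, h5, h6⟩ := h
  exact ⟨κ, hκ, l, P, a, h1, h2, h3, h4, h5, huv.trans h6⟩

lemma zpow_floor_sub_floor_le {b : ℝ} (hb : 1 < b) {x y : ℝ} :
    b ^ (⌊x⌋ - ⌊y⌋) ≤ b ^ (x - y + 1) := by
  rw [← Real.rpow_intCast]
  refine Real.rpow_le_rpow_of_exponent_le hb.le ?_
  push_cast
  linarith [Int.floor_le x, Int.lt_floor_add_one y]

lemma le_zpow_floor_sub_floor {b : ℝ} (hb : 1 < b) {x y : ℝ} :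
    b ^ (x - y - 1) ≤ b ^ (⌊x⌋ - ⌊y⌋) := by
  rw [← Real.rpow_intCast]
  refine Real.rpow_le_rpow_of_exponent_le hb.le ?_
  push_cast
  linarith [Int.floor_le y, Int.lt_floor_add_one x]

lemma sqrt_four_rpow (x : ℝ) : √((4 : ℝ) ^ x) = 2 ^ x := by
  rw [Real.sqrt_eq_iff_mul_self_eq (by positivity) (by positivity), ← Real.mul_rpow (by norm_num)
    (by norm_num)]
  norm_num

/-- Lower bound for `tubeEntropy` at the scale shifted by `s`, where `4 ^ (χ j * s)` is comparable
to the number of summands. -/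
lemma le_tubeEntropy {χ : Fin d → ℝ} (hχ : ∀ i, 0 < χ i) {X : ℝ} (hX : ∀ i, χ i ≤ X)
    {θ : Measure (EuclideanSpace ℝ (Fin d))} [IsProbabilityMeasure θ] (hθ : IsBoundedMeasure θ)
    {L : Fin d → ℕ} {q a s m k : ℕ} {j : Fin d} (has : a + s = q + L j) (hk : 0 < k)
    {v : ℝ} (hv : 0 < v) (hv1 : v ≤ 1) (hvar : HasVariance θ (offsetLevel χ L q) j v)
    (hk1 : (4 : ℝ) ^ (χ j * s) ≤ k) (hk2 : (k : ℝ) ≤ 4 ^ (χ j * (s + 1)))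
    (hoff : ∀ i ≠ j, χ j * (s + 1) + χ i * ((L j : ℝ) - s + m - L i) ≤ 0)
    (hs : χ j * (s + 1) ≤ 3 * (χ j * ((s : ℝ) - m)) - 3) :
    χ j * m * Real.log 2 - Real.log 12 + Real.log v / 2 -
      d * (entropyConst + Real.log (1 + 4 ^ (X + 1))) ≤
      tubeEntropy χ θ j m k a * Real.log 2 := by
  have hk' : (0 : ℝ) < k := by exact_mod_cast hk
  have has' : (a : ℝ) + s = q + L j := by exact_mod_cast has
  have hpν : IsProbabilityMeasure (selfConv θ k) := by
    rw [selfConv_eq_sumLaw]; infer_instance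
  rw [tubeEntropy_mul_log_two hχ (isBoundedMeasure_sumLaw fun _ => hθ) j]
  obtain ⟨κ, hκ, l, P, b, hl, hl1, hP, hmix, hbox, hvar⟩ := hvar
  have hle : level χ (a : ℤ) ≤ level χ ((a : ℤ) + m) := level_mono hχ (by omega)
  have hmain := tube_entropy_lower_bound l hl hl1 P hmix hθ (offsetLevel χ L q) b hbox j hv hv1
    hvar hle hk (B := 4 ^ (X + 1)) ?_ ?_ ?_
  · refine le_trans ?_ hmain
    -- The factor `2^(χ_j s)` in the relative cell width cancels against `√k`, leaving `2^(-χ_j m)`;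
    -- rounding the levels costs the factor from `6` to `12`.
    have h1 : 6 * (2 : ℝ) ^ (offsetLevel χ L q j - level χ ((a : ℤ) + m) j) / √(k * v) ≤
        12 * 2 ^ (-(χ j * m)) / √v := by
      have e1 : (2 : ℝ) ^ (offsetLevel χ L q j - level χ ((a : ℤ) + m) j) ≤
          2 ^ (χ j * ((s : ℝ) - m) + 1) := by
        refine (zpow_floor_sub_floor_le one_lt_two).trans
          (Real.rpow_le_rpow_of_exponent_le one_le_two (le_of_eq ?_))
        push_cast
        rw [← has']; ring
      have e2 : (2 : ℝ) ^ (χ j * s) ≤ √k := by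
        rw [← sqrt_four_rpow]; exact Real.sqrt_le_sqrt hk1
      have e3 : (2 : ℝ) ^ (χ j * ((s : ℝ) - m) + 1) = 2 ^ (χ j * s) * 2 ^ (-(χ j * m)) * 2 := by
        rw [← Real.rpow_add two_pos, Real.rpow_add_one two_ne_zero]
        congr 2; ring
      rw [Real.sqrt_mul hk'.le, div_le_div_iff₀ (by positivity) (by positivity)]
      calc _ ≤ 6 * (2 ^ (χ j * s) * 2 ^ (-(χ j * m)) * 2) * √v := by rw [← e3]; gcongr
        _ = 12 * 2 ^ (-(χ j * m)) * (2 ^ (χ j * s) * √v) := by ring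
        _ ≤ _ := by gcongr
    have h2 := Real.log_le_log (by positivity) h1
    have h3 : Real.log (12 * 2 ^ (-(χ j * m)) / √v) =
        Real.log 12 + -(χ j * m) * Real.log 2 - Real.log v / 2 := by
      rw [Real.log_div (by positivity) (by positivity), Real.log_mul (by norm_num) (by positivity),
        Real.log_rpow two_pos, Real.log_sqrt hv.le]
    rw [h3] at h2
    linarith
  · refine (mul_le_mul hk2 (zpow_floor_sub_floor_le (by norm_num)) (by positivity)
      (by positivity)).trans ?_
    rw [← Real.rpow_add (by norm_num)]
    refine Real.rpow_le_rpow_of_exponent_le (by norm_num) ?_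
    have : (((a : ℕ) : ℤ) : ℝ) = q + L j - s := by push_cast; linarith
    rw [this]
    have := hX j
    linarith
  · intro i hi
    refine (mul_le_mul hk2 (zpow_floor_sub_floor_le (by norm_num)) (by positivity)
      (by positivity)).trans ?_
    rw [← Real.rpow_add (by norm_num)]
    refine Real.rpow_le_rpow_of_exponent_le (by norm_num) ?_
    have : (((a : ℤ) + m : ℤ) : ℝ) = q + L j - s + m := by push_cast; linarith
    rw [this]
    have h1 := hoff i hi
    have h2 := (hχ i).trans_le (hX i)
    linarith
  · have e2 : √(k : ℝ) ≤ 2 ^ (χ j * (s + 1)) := by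
      rw [← sqrt_four_rpow]; exact Real.sqrt_le_sqrt hk2
    refine e2.trans ?_
    have e1 : (2 : ℝ) ^ (χ j * ((s : ℝ) - m) - 1) ≤
        (2 : ℝ) ^ (offsetLevel χ L q j - level χ ((a : ℤ) + m) j) := by
      refine le_trans (Real.rpow_le_rpow_of_exponent_le one_le_two (le_of_eq ?_))
        (le_zpow_floor_sub_floor one_lt_two)
      push_cast
      rw [← has']; ring
    refine le_trans ?_ (pow_le_pow_left₀ (by positivity) e1 3)
    rw [← Real.rpow_mul_natCast zero_le_two]
    refine Real.rpow_le_rpow_of_exponent_le one_le_two ?_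
    push_cast
    linarith

/-- A measure of large entropy has, in some direction, components of nontrivial variance at a
positive proportion of scales. -/
lemma exists_many_hasVariance (hd : 0 < d) {χ : Fin d → ℝ} (hχ : ∀ i, 0 < χ i) {X : ℝ}
    (hX : ∀ i, χ i ≤ X) {θ : Measure (EuclideanSpace ℝ (Fin d))} [IsProbabilityMeasure θ]
    (hcpt : IsCompact θ.support) {ε : ℝ} (hε : 0 < ε) (hdiam : Metric.diam θ.support ≤ ε⁻¹)
    {n : ℕ} (hn : 0 < n) (hent : ε < 1 / (n : ℝ) * entropy θ (partitionE χ (n : ℤ)))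
    (L : Fin d → ℕ) {M : ℕ} (hM1 : 1 ≤ M) (hM : 8 * d * entropyConst ≤ M * ε) {R : ℝ}
    (hL : ∀ i, (L i : ℝ) ≤ R)
    (hnR : d * (entropyConst + Real.log (1 + 4 ^ (X * (M + R)) * (ε⁻¹) ^ 2)) ≤ n * ε / 4) :
    ∃ j : Fin d, n * (ε / (8 * 4 ^ (X * M + 1)) / (2 * d)) ≤
      {q : ℕ | q < n ∧ HasVariance θ (offsetLevel χ L q) j
        (ε / (8 * 4 ^ (X * M + 1)) / (2 * d))}.ncard := by
  classical
  have hn' : (0 : ℝ) < n := by exact_mod_cast hn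
  have hM' : (1 : ℝ) ≤ M := by exact_mod_cast hM1
  have hae : ∀ᵐ x ∂θ, x ∈ θ.support := Measure.support_mem_ae
  have hθ : IsBoundedMeasure θ := by
    obtain ⟨R, hR⟩ := hcpt.isBounded.exists_norm_le
    exact ⟨R, by filter_upwards [hae] with x hx using hR x hx⟩
  have hlog : (1 / 2 : ℝ) ≤ Real.log 2 := by linarith [Real.log_two_gt_d9]
  set G : ℕ → ℝ := fun q => mapEntropy θ (boxIndex (offsetLevel χ L q)) with hG
  have hGmono : Monotone G := fun a b hab => mapEntropy_box_mono hθ (offsetLevel_mono hχ L hab)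
  -- The offset boxes refine `ℰ_n`; the factor `1/2` is a lower bound for `log 2`, from the change
  -- of base.
  have hGn : n * ε / 2 ≤ G n := by
    obtain ⟨T, hT⟩ := hθ.exists_finset (level χ (n : ℤ))
    have h1 := entropy_mul_log_two (partitionE_isIndexedBy χ n) hT
    have h2 := mapEntropy_box_mono hθ (level_le_offsetLevel hχ L n)
    have h3 : n * ε < entropy θ (partitionE χ (n : ℤ)) := by
      rw [one_div, inv_mul_eq_div, lt_div_iff₀ hn'] at hent
      linarith
    have h4 : n * ε * (1 / 2) ≤ entropy θ (partitionE χ (n : ℤ)) * Real.log 2 :=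
      mul_le_mul h3.le hlog (by norm_num) (by nlinarith)
    have h5 : G n = mapEntropy θ (boxIndex (offsetLevel χ L n)) := rfl
    rw [h5]
    linarith
  have hvar : ∀ i, variance (fun x : EuclideanSpace ℝ (Fin d) => x i) θ ≤ (ε⁻¹) ^ 2 := by
    intro i
    obtain ⟨x₀, hx₀⟩ := Measure.nonempty_support (μ := θ) (IsProbabilityMeasure.ne_zero θ)
    have h1 : ∀ᵐ x ∂θ, x i ∈ Set.Icc (x₀ i - ε⁻¹) (x₀ i + ε⁻¹) := by
      filter_upwards [hae] with x hx
      have h2 := (Metric.dist_le_diam_of_mem hcpt.isBounded hx hx₀).trans hdiam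
      rw [dist_eq_norm] at h2
      have h3 := abs_le.1 ((PiLp.norm_apply_le (x - x₀) i).trans h2)
      rw [PiLp.sub_apply] at h3
      constructor <;> linarith [h3.1, h3.2]
    refine (variance_le_sq_of_bounded h1 (by fun_prop)).trans (le_of_eq ?_)
    ring
  have hGM : G M ≤ n * ε / 4 := by
    refine (mapEntropy_box_le_sum hθ _).trans (le_trans ?_ hnR)
    calc _ ≤ ∑ _i : Fin d, (entropyConst + Real.log (1 + 4 ^ (X * (M + R)) * (ε⁻¹) ^ 2)) := by
          refine Finset.sum_le_sum fun i _ => (mapEntropy_coord_le_log hθ _ i).trans ?_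
          have h1 : (4 : ℝ) ^ (offsetLevel χ L M i) ≤ 4 ^ (X * (M + R)) := by
            rw [← Real.rpow_intCast]
            refine Real.rpow_le_rpow_of_exponent_le (by norm_num) ((Int.floor_le _).trans ?_)
            exact mul_le_mul (hX i) (by linarith [hL i]) (by positivity)
              ((hχ i).le.trans (hX i))
          have h2 := variance_nonneg (fun x : EuclideanSpace ℝ (Fin d) => x i) θ
          have h3 := hvar i
          gcongr
      _ = _ := by simp [mul_add]
  choose! v hv0 hv1 hvinc hvH using fun q : ℕ =>
    exists_variance_of_entropy_increment hθ (offsetLevel_mono hχ L (Nat.le_add_right q M))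
  set Y : ℝ := 4 ^ (X * M + 1) with hY
  have hY0 : 0 < Y := by positivity
  have hinc : ∀ q, G (q + M) - G q ≤ d * entropyConst + Y * ∑ j, v q j := by
    intro q
    refine (hvinc q).trans ?_
    rw [Finset.sum_add_distrib, Finset.mul_sum]
    refine add_le_add (by simp) (Finset.sum_le_sum fun j _ =>
      mul_le_mul_of_nonneg_right ?_ (hv0 q j))
    refine (zpow_floor_sub_floor_le (by norm_num)).trans
      (Real.rpow_le_rpow_of_exponent_le (by norm_num) ?_)
    push_cast
    have := mul_le_mul_of_nonneg_right (hX j) (by positivity : (0 : ℝ) ≤ M)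
    linarith
  have hsum := (mul_sub_le_sum_range_shift hGmono n M).trans (Finset.sum_le_sum fun q _ => hinc q)
  rw [Finset.sum_add_distrib, Finset.sum_const, Finset.card_range, nsmul_eq_mul,
    ← Finset.mul_sum] at hsum
  -- The total increment is at least `M n ε / 4`. The choice of `M` makes the additive constants
  -- cost at most half of it.
  have hlow : n * (ε / 8) ≤ Y * ∑ q ∈ Finset.range n, ∑ j, v q j := by
    have h1 : (M : ℝ) * (n * ε / 4) ≤ M * (G n - G M) := by gcongr; linarith
    have h2 : n * (8 * d * entropyConst) ≤ n * (M * ε) := by gcongr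
    have h3 : n * (1 * ε) ≤ n * (M * ε) := by gcongr
    linarith
  have hfin : n * (ε / (8 * Y)) ≤ ∑ q ∈ Finset.range n, ∑ j, v q j := by
    have : n * (ε / (8 * Y)) = n * (ε / 8) / Y := by field_simp
    rw [this, div_le_iff₀ hY0]
    linarith
  obtain ⟨j, hj⟩ := exists_many_large hd hv1 (by positivity) hfin
  refine ⟨j, hj.trans ?_⟩
  rw [← Set.ncard_coe_finset]
  refine Nat.cast_le.2 (Set.ncard_le_ncard (fun q hq => ?_)
    ((Set.finite_lt_nat n).subset fun q hq => hq.1))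
  rw [Finset.mem_coe, Finset.mem_filter, Finset.mem_range] at hq
  exact ⟨hq.1, (hvH q j).mono hq.2⟩

/-! ### Choice and separation of the scales -/

lemma antitone_of_succ_le {k : Fin d → ℕ} (h : ∀ j j' : Fin d, (j' : ℕ) = j + 1 → k j' ≤ k j) :
    Antitone k := by
  have key : ∀ (t : ℕ) (i : Fin d) (ht : (i : ℕ) + t < d), k ⟨i + t, ht⟩ ≤ k i := by
    intro t
    induction t with
    | zero => exact fun i _ => le_rfl
    | succ t ih => exact fun i ht =>
        (h ⟨i + t, by omega⟩ ⟨i + (t + 1), ht⟩ (by simp; omega)).trans (ih i (by omega))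
  intro i j hij
  have hij' : (i : ℕ) ≤ j := hij
  have := key (j - i) i (by omega)
  rwa [show (⟨i + (j - i), by omega⟩ : Fin d) = j from Fin.ext (by simp only; omega)] at this

/-- The number of summands in the next direction, or zero in the last direction. -/
def nextScale (k : Fin d → ℕ) (i : Fin d) : ℕ :=
  if h : (i : ℕ) + 1 < d then k ⟨i + 1, h⟩ else 0

lemma nextScale_le {k m : Fin d → ℕ} (h : ∀ j j' : Fin d, (j' : ℕ) = j + 1 → k j' ≤ m j)
    (i : Fin d) : nextScale k i ≤ m i := by
  unfold nextScale
  split_ifs with hi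
  · exact h i _ rfl
  · exact Nat.zero_le _

lemma le_nextScale {k : Fin d → ℕ} (hk : Antitone k) {i j : Fin d} (hij : i < j) :
    k j ≤ nextScale k i := by
  have hij' : (i : ℕ) < j := hij
  have hi : (i : ℕ) + 1 < d := by omega
  rw [nextScale, dif_pos hi]
  exact hk (show (i : ℕ) + 1 ≤ j from hij')

lemma exists_gap {χ : Fin d → ℝ} (hχ : StrictMono χ) :
    ∃ g : ℝ, 0 < g ∧ ∀ i j, j < i → g ≤ χ i - χ j := by
  rcases isEmpty_or_nonempty (Fin d) with h | h
  · exact ⟨1, one_pos, fun i => h.elim i⟩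
  obtain ⟨p, hp⟩ := Finite.exists_min
    fun p : Fin d × Fin d => if p.2 < p.1 then χ p.1 - χ p.2 else 1
  refine ⟨_, ?_, fun i j hij => (hp (i, j)).trans (by simp [hij])⟩
  split_ifs with h1
  · exact sub_pos.2 (hχ h1)
  · exact one_pos

/-- The gauge function of the scale separation. -/
noncomputable def gauge (D x : ℝ) : ℝ := D * x ^ 2 * 2 ^ (D * x)

lemma le_gauge {D x : ℝ} (hD : 1 ≤ D) (hx : 1 ≤ x) : D * x ^ 2 < gauge D x := by
  have h1 : (1 : ℝ) < 2 ^ (D * x) := Real.one_lt_rpow one_lt_two (by positivity)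
  exact lt_mul_of_one_lt_right (by positivity) h1

lemma mul_le_gauge {D x : ℝ} (hD : 1 ≤ D) (hx : 1 ≤ x) : D * x ≤ gauge D x := by
  refine le_trans ?_ (le_gauge hD hx).le
  have : x ≤ x ^ 2 := by nlinarith
  gcongr

lemma self_le_gauge {D x : ℝ} (hD : 1 ≤ D) (hx : 1 ≤ x) : x ≤ gauge D x :=
  le_trans (by nlinarith) (mul_le_gauge hD hx)

lemma log_four_bounds : 1 ≤ Real.log 4 ∧ Real.log 4 ≤ 2 := by
  have h : Real.log 4 = 2 * Real.log 2 := by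
    rw [show (4 : ℝ) = 2 ^ 2 by norm_num, Real.log_pow]; norm_num
  constructor <;> linarith [Real.log_two_gt_d9, Real.log_two_lt_d9]

/-- The scale shift produced by `k`-fold convolution in a direction of exponent `χ`. -/
lemma exists_scale_shift {χ X A D : ℝ} (hχ : 0 < χ) (hX : χ ≤ X) (hD : 1 ≤ D)
    (hDA : 2 * X * (A + 1) ≤ D) {m k : ℕ} (hm : 1 ≤ m) (hk : 1 ≤ k) (hmk : gauge D m ≤ k) :
    ∃ s : ℕ, (4 : ℝ) ^ (χ * s) ≤ k ∧ (k : ℝ) ≤ 4 ^ (χ * (s + 1)) ∧ A * m ≤ s ∧ χ * s ≤ k := by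
  have hm' : (1 : ℝ) ≤ m := by exact_mod_cast hm
  have hk' : (1 : ℝ) ≤ k := by exact_mod_cast hk
  have hk0 : (0 : ℝ) < k := by linarith
  set ℓ := Real.logb 4 k with hℓ
  have hℓ0 : 0 ≤ ℓ := Real.logb_nonneg (by norm_num) hk'
  have hpow : (4 : ℝ) ^ ℓ = k := Real.rpow_logb (by norm_num) (by norm_num) hk0
  have h1 : χ * (⌊ℓ / χ⌋₊ : ℝ) ≤ ℓ := by
    have := Nat.floor_le (div_nonneg hℓ0 hχ.le)
    rw [le_div_iff₀ hχ] at this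
    linarith
  have h2 : ℓ ≤ χ * ((⌊ℓ / χ⌋₊ : ℝ) + 1) := by
    have := (Nat.lt_floor_add_one (ℓ / χ)).le
    rw [div_le_iff₀ hχ] at this
    linarith
  -- The exponential factor in `gauge` is what makes the logarithm of `k` dominate `m`.
  have h3 : D * m / 2 ≤ ℓ := by
    rw [hℓ, Real.le_logb_iff_rpow_le (by norm_num) hk0]
    have e : (4 : ℝ) ^ (D * m / 2) = 2 ^ (D * m) := by
      rw [show (4 : ℝ) = 2 ^ (2 : ℝ) by norm_num, ← Real.rpow_mul zero_le_two]
      congr 1; ring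
    rw [e]
    refine le_trans ?_ hmk
    have : (1 : ℝ) ≤ D * m ^ 2 := by nlinarith
    exact le_mul_of_one_le_left (by positivity) this
  refine ⟨⌊ℓ / χ⌋₊, ?_, ?_, ?_, ?_⟩
  · rw [← hpow]
    exact Real.rpow_le_rpow_of_exponent_le (by norm_num) h1
  · rw [← hpow]
    exact Real.rpow_le_rpow_of_exponent_le (by norm_num) h2
  · have h4 : X * (A + 1) * m ≤ X * ((⌊ℓ / χ⌋₊ : ℝ) + 1) := by
      have h5 : χ * ((⌊ℓ / χ⌋₊ : ℝ) + 1) ≤ X * ((⌊ℓ / χ⌋₊ : ℝ) + 1) := by gcongr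
      have h6 : 2 * X * (A + 1) * m ≤ D * m := by gcongr
      linarith
    have h7 : (A + 1) * m ≤ (⌊ℓ / χ⌋₊ : ℝ) + 1 := by
      rw [mul_assoc] at h4
      exact le_of_mul_le_mul_left h4 (hχ.trans_le hX)
    linarith
  · refine h1.trans ?_
    rw [hℓ, Real.logb]
    have h8 := Real.log_le_sub_one_of_pos hk0
    rw [div_le_iff₀ (by linarith [log_four_bounds.1])]
    nlinarith [log_four_bounds.1]

/-- Shifting a set of scales loses only a bounded number of them. -/
lemma ncard_shift_le {S Q : Set ℕ} {n L s : ℕ} (hS : ∀ q ∈ S, q < n) (hQ : Q.Finite)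
    (h : ∀ q ∈ S, ∀ a, a + s = q + L → 1 ≤ a → a ≤ n → a ∈ Q) :
    S.ncard ≤ Q.ncard + (s + 1) + L := by
  -- Scales whose shift lies in `[1, n]`, scales `q ≤ s` where the shift may fail to be positive,
  -- and the last `L` scales where it may exceed `n`.
  have hsub : S ⊆ (S ∩ {q | s < q + L ∧ q + L ≤ n + s}) ∪
      (Finset.range (s + 1) : Set ℕ) ∪ (Finset.Ico (n - L) n : Set ℕ) := by
    intro q hq
    have := hS q hq
    simp only [Set.mem_union, Set.mem_inter_iff, Set.mem_ofPred_eq, Finset.coe_range, Set.mem_Iio,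
      Finset.coe_Ico, Set.mem_Ico]
    by_cases h1 : s < q + L ∧ q + L ≤ n + s
    · exact Or.inl (Or.inl ⟨hq, h1⟩)
    · by_cases h2 : q < s + 1
      · exact Or.inl (Or.inr h2)
      · exact Or.inr (by omega)
  have hSfin : S.Finite := (Set.finite_lt_nat n).subset hS
  have h1 : (S ∩ {q | s < q + L ∧ q + L ≤ n + s}).ncard ≤ Q.ncard := by
    refine Set.ncard_le_ncard_of_injOn (fun q => q + L - s) (fun q hq => ?_)
      (fun q hq q' hq' hqq => ?_) hQ
    · obtain ⟨hq, h2, h3⟩ := hq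
      exact h q hq _ (by omega) (by omega) (by omega)
    · obtain ⟨-, h2, -⟩ := hq
      obtain ⟨-, h3, -⟩ := hq'
      simp only at hqq
      omega
  refine (Set.ncard_le_ncard hsub ((hSfin.inter_of_left _).union (Finset.finite_toSet _) |>.union
    (Finset.finite_toSet _))).trans ?_
  refine (Set.ncard_union_le _ _).trans (add_le_add ((Set.ncard_union_le _ _).trans
    (add_le_add h1 ?_)) ?_)
  · simp
  · rw [Set.ncard_coe_finset, Nat.card_Ico]; omega

lemma lyapunovExponent_pos {Λ : Type*} [Fintype Λ] {d : ℕ} {r : Λ → Fin d → ℝ}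
    (hr0 : ∀ i j, r i j ≠ 0) (hr1 : ∀ i j, |r i j| < 1) {p : Λ → ℝ} (hp0 : ∀ i, 0 ≤ p i)
    (hp1 : ∑ i, p i = 1) (j : Fin d) : 0 < lyapunovExponent p r j := by
  have hlog : ∀ i, Real.logb 2 |r i j| < 0 := fun i =>
    Real.logb_neg one_lt_two (abs_pos.2 (hr0 i j)) (hr1 i j)
  obtain ⟨i, hi⟩ : ∃ i, 0 < p i := by
    by_contra! h
    have : ∑ i, p i ≤ 0 := Finset.sum_nonpos fun i _ => h i
    linarith
  rw [lyapunovExponent, neg_pos]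
  exact Finset.sum_neg' (fun i _ => mul_nonpos_of_nonneg_of_nonpos (hp0 i) (hlog i).le)
    ⟨i, Finset.mem_univ i, mul_neg_of_pos_of_neg hi (hlog i)⟩

/-- Almost full tube entropy at a scale coming from a component of nontrivial variance. -/
lemma lt_tubeEntropy_of_hasVariance {χ : Fin d → ℝ} (hχ : ∀ i, 0 < χ i) {X : ℝ}
    (hX : ∀ i, χ i ≤ X) {g K A x₀ : ℝ} (hx₀ : 0 < x₀) (hx₀χ : ∀ i, x₀ ≤ χ i)
    (hg : 0 < g) (hgap : ∀ i j, j < i → g ≤ χ i - χ j)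
    (hK : 2 * (1 + X) ≤ x₀ * K) (hA1 : X * (K + 2) ≤ g * A) (hA2 : 2 + 3 / x₀ ≤ A)
    {θ : Measure (EuclideanSpace ℝ (Fin d))} [IsProbabilityMeasure θ] (hθ : IsBoundedMeasure θ)
    {L : Fin d → ℕ} {j : Fin d} {q a s m k : ℕ} (has : a + s = q + L j) (hk : 0 < k)
    (hm : 1 ≤ m)
    (hLj : (L j : ℝ) ≤ K * m) (hmk : 2 * (m : ℝ) ≤ k) (hL : ∀ i < j, K * (k : ℝ) ≤ L i)
    (hk1 : (4 : ℝ) ^ (χ j * s) ≤ k) (hk2 : (k : ℝ) ≤ 4 ^ (χ j * (s + 1)))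
    (hs1 : A * m ≤ s) (hs2 : χ j * s ≤ k)
    {v ε : ℝ} (hv : 0 < v) (hv1 : v ≤ 1) (hvar : HasVariance θ (offsetLevel χ L q) j v)
    (hm2 : Real.log 12 + d * (entropyConst + Real.log (1 + 4 ^ (X + 1))) - Real.log v / 2 <
      ε * m * Real.log 2) :
    χ j - ε < 1 / (m : ℝ) * tubeEntropy χ θ j m k a := by
  have hm' : (1 : ℝ) ≤ m := by exact_mod_cast hm
  have hk' : (1 : ℝ) ≤ k := by exact_mod_cast hk
  have hX0 : 0 < X := (hχ j).trans_le (hX j)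
  have hK0 : 0 < K := by
    by_contra! h
    nlinarith
  have hA0 : 2 ≤ A := by have : 0 < 3 / x₀ := by positivity
                         linarith
  have hsm : (m : ℝ) ≤ s := by nlinarith
  have hmain := le_tubeEntropy (m := m) hχ hX hθ has hk hv hv1 hvar hk1 hk2 ?_ ?_
  · rw [one_div, inv_mul_eq_div, lt_div_iff₀ (by linarith)]
    have hlog2 : 0 < Real.log 2 := Real.log_pos one_lt_two
    refine lt_of_mul_lt_mul_right (a := Real.log 2) ?_ hlog2.le
    refine lt_of_lt_of_le ?_ hmain
    linarith
  · intro i hi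
    -- For `i < j` the offset `L i ≥ K k` beats both `χ_j s ≤ k` and `L j`. For `i > j` the gap
    -- gives `(χ_i - χ_j) s ≥ g A m`, which beats the terms of size `m`.
    rcases lt_or_gt_of_ne hi with hij | hij
    · have h1 := hL i hij
      have h2 : (L j : ℝ) - s + m - L i ≤ -(K * k / 2) := by
        have : K * (2 * m) ≤ K * k := by gcongr
        linarith
      have h3 : χ i * ((L j : ℝ) - s + m - L i) ≤ χ i * (-(K * k / 2)) :=
        mul_le_mul_of_nonneg_left h2 (hχ i).le
      have h4 : x₀ * (K * k / 2) ≤ χ i * (K * k / 2) := by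
        have := hx₀χ i; gcongr
      have h5 : 2 * (1 + X) * k ≤ x₀ * K * k := by gcongr
      have h6 := hX j
      have h7 : X * 1 ≤ X * k := by gcongr
      linarith
    · have h1 := hgap i j hij
      have h2 : (0 : ℝ) ≤ L i := Nat.cast_nonneg _
      have h3 : χ i * ((L j : ℝ) - s + m - L i) ≤ χ i * (K * m - s + m) :=
        mul_le_mul_of_nonneg_left (by linarith) (hχ i).le
      have h4 : χ i * ((K + 1) * m) ≤ X * ((K + 1) * m) := by have := hX i; gcongr
      have h5 : g * (A * m) ≤ (χ i - χ j) * s :=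
        mul_le_mul h1 hs1 (by positivity) (hg.le.trans h1)
      have h6 : X * (K + 2) * m ≤ g * A * m := by gcongr
      have h7 : X * 1 ≤ X * m := by gcongr
      have h8 := hX j
      linarith
  · have h1 : (2 + 3 / x₀) * m ≤ s := le_trans (by gcongr) hs1
    have h2 : χ j * ((2 + 3 / x₀) * m) ≤ χ j * s := mul_le_mul_of_nonneg_left h1 (hχ j).le
    have h3 : 3 ≤ χ j * (3 / x₀) := by
      have := hx₀χ j
      rw [mul_div_assoc', le_div_iff₀ hx₀]
      linarith
    have h4 : 3 * (m : ℝ) ≤ χ j * (3 / x₀) * m := by gcongr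
    have h5 : χ j * 1 ≤ χ j * m := mul_le_mul_of_nonneg_left hm' (hχ j).le
    linarith

/-- With `Z = X M` and `M = O(1/ε)`, the loss from the variance threshold is linear in `1/ε`, hence
absorbed by `ε m`. -/
lemma neg_log_variance_le (hd : 1 ≤ d) {ε Z : ℝ} (hε : 0 < ε) (hZ : 0 ≤ Z) :
    -Real.log (ε / (8 * 4 ^ (Z + 1)) / (2 * d)) ≤ 16 * d + 2 * (Z + 1) + ε⁻¹ := by
  have hd' : (1 : ℝ) ≤ d := by exact_mod_cast hd
  rw [← Real.log_inv]
  have e : (ε / (8 * (4 : ℝ) ^ (Z + 1)) / (2 * d))⁻¹ = 16 * d * 4 ^ (Z + 1) * ε⁻¹ := by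
    field_simp; ring
  rw [e, Real.log_mul (by positivity) (by positivity), Real.log_mul (by positivity)
    (by positivity), Real.log_rpow (by norm_num)]
  have h1 := Real.log_le_sub_one_of_pos (by positivity : (0 : ℝ) < 16 * d)
  have h2 := Real.log_le_sub_one_of_pos (by positivity : (0 : ℝ) < ε⁻¹)
  have h3 : (Z + 1) * Real.log 4 ≤ (Z + 1) * 2 :=
    mul_le_mul_of_nonneg_left log_four_bounds.2 (by positivity)
  linarith

lemma log_initial_entropy_le {ε Z : ℝ} (hε : 0 < ε) (hε1 : ε < 1) (hZ : 0 ≤ Z) :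
    Real.log (1 + 4 ^ Z * (ε⁻¹) ^ 2) ≤ 1 + 2 * Z + 2 * ε⁻¹ := by
  have hE : 1 ≤ ε⁻¹ := (one_le_inv₀ hε).2 hε1.le
  have h4 : (1 : ℝ) ≤ 4 ^ Z := Real.one_le_rpow (by norm_num) hZ
  have h0 : (1 : ℝ) ≤ 4 ^ Z * (ε⁻¹) ^ 2 := one_le_mul_of_one_le_of_one_le h4 (one_le_pow₀ hE)
  have h1 : Real.log (1 + 4 ^ Z * (ε⁻¹) ^ 2) ≤ Real.log (2 * (4 ^ Z * (ε⁻¹) ^ 2)) :=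
    Real.log_le_log (by positivity) (by linarith)
  rw [Real.log_mul (by norm_num) (by positivity), Real.log_mul (by positivity) (by positivity),
    Real.log_rpow (by norm_num), Real.log_pow] at h1
  have h2 := Real.log_le_sub_one_of_pos (by positivity : (0 : ℝ) < ε⁻¹)
  have h3 : Z * Real.log 4 ≤ Z * 2 := mul_le_mul_of_nonneg_left log_four_bounds.2 hZ
  have h5 := Real.log_two_lt_d9
  push_cast at h1
  linarith

set_option maxHeartbeats 1000000 in
/-- Entropy growth under convolution for a general strictly increasing family of positive
exponents. -/
theorem exists_many_full_tube_scales (hd : 0 < d) {χ : Fin d → ℝ} (hχ0 : ∀ i, 0 < χ i)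
    (hχ : StrictMono χ) :
    ∃ f : ℝ → ℝ, ∀ ε : ℝ, 0 < ε → ε < 1 → ∃ δ : ℝ, 0 < δ ∧
      ∀ (m k : Fin d → ℕ) (n : ℕ),
        (∀ j, 0 < m j) → (∀ j, 0 < k j) → 0 < n →
        f ε⁻¹ ≤ (m ⟨d - 1, by omega⟩ : ℝ) →
        f (k ⟨0, by omega⟩ : ℝ) ≤ (n : ℝ) →
        (∀ j, f (m j : ℝ) ≤ (k j : ℝ)) →
        (∀ j j' : Fin d, (j' : ℕ) = (j : ℕ) + 1 → f (k j' : ℝ) ≤ (m j : ℝ)) →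
        ∀ (θ : Measure (EuclideanSpace ℝ (Fin d))) [IsProbabilityMeasure θ],
          IsCompact θ.support →
          Metric.diam θ.support ≤ ε⁻¹ →
          ε < 1 / (n : ℝ) * entropy θ (partitionE χ (n : ℤ)) →
          ∃ j : Fin d,
            δ < 1 / (n : ℝ) *
              (({q : ℕ | 1 ≤ q ∧ q ≤ n ∧
                χ j - ε < 1 / (m j : ℝ) * tubeEntropy χ θ j (m j) (k j) q}.ncard : ℕ) : ℝ) := by
  set x₀ : ℝ := χ ⟨0, hd⟩ with hx₀def
  set X : ℝ := χ ⟨d - 1, by omega⟩ with hXdef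
  have hx₀ : 0 < x₀ := hχ0 _
  have hx₀χ : ∀ i, x₀ ≤ χ i := fun i => hχ.monotone (Nat.zero_le i.1)
  have hX : ∀ i, χ i ≤ X := fun i => hχ.monotone (show i.1 ≤ d - 1 by omega)
  have hX0 : 0 < X := hχ0 _
  obtain ⟨g, hg, hgap⟩ := exists_gap hχ
  set K : ℕ := ⌈2 * (1 + X) / x₀⌉₊ with hKdef
  have hK : 2 * (1 + X) ≤ x₀ * K := by
    have := Nat.le_ceil (2 * (1 + X) / x₀)
    rw [div_le_iff₀ hx₀] at this
    linarith
  have hK0 : (0 : ℝ) ≤ K := Nat.cast_nonneg K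
  set A : ℝ := X * (K + 2) / g + (2 + 3 / x₀) with hAdef
  have hA1 : X * (K + 2) ≤ g * A := by
    have h1 : g * A = X * (K + 2) + g * (2 + 3 / x₀) := by rw [hAdef]; field_simp
    have h2 : 0 < g * (2 + 3 / x₀) := by positivity
    linarith
  have hA2 : 2 + 3 / x₀ ≤ A := by
    have : 0 ≤ X * (K + 2) / g := by positivity
    linarith
  have hA0 : 0 < A := lt_of_lt_of_le (by positivity) hA2
  have hC0 := three_le_entropyConst
  have hd' : (1 : ℝ) ≤ d := by exact_mod_cast hd
  set C : ℝ := entropyConst with hC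
  set M₀ : ℝ := 8 * d * C + 1 with hM₀
  have hM₀1 : 1 ≤ M₀ := by have : 0 ≤ 8 * d * C := by positivity
                           linarith
  set W : ℝ := d * (C + Real.log (1 + 4 ^ (X + 1))) with hW
  have hW0 : 0 ≤ W := by
    have : 0 ≤ Real.log (1 + (4 : ℝ) ^ (X + 1)) :=
      Real.log_nonneg (by have : (0 : ℝ) < 4 ^ (X + 1) := by positivity
                          linarith)
    positivity
  -- One constant per requirement: `D₁` makes the shift at least `A m`; `D₂` makes `ε m` exceed the
  -- errors in the tube entropy; `D₃` makes the initial entropy at most `n ε / 4`; `D₄` and `D₅`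
  -- make the number of scales lost in the shift less than `n c / 2`.
  set D₁ : ℝ := 2 * X * (A + 1) with hD₁
  set D₂ : ℝ := 2 * (11 + W + (16 * d + 2 * (X * M₀ + 1) + 1)) with hD₂
  set D₃ : ℝ := 4 * (d * (C + 1 + 2 * (X * (M₀ + K)) + 2)) with hD₃
  set D₄ : ℝ := 32 * d * (2 + 1 / x₀ + K) with hD₄
  set D₅ : ℝ := 2 * (X * M₀ + 1) + 3 with hD₅
  have p₁ : 0 ≤ D₁ := by positivity
  have p₂ : 0 ≤ D₂ := by positivity
  have p₃ : 0 ≤ D₃ := by positivity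
  have p₄ : 0 ≤ D₄ := by positivity
  have p₅ : 0 ≤ D₅ := by positivity
  set D : ℝ := D₁ + D₂ + D₃ + D₄ + D₅ + 2 with hDdef
  have hD1 : 1 ≤ D := by linarith
  clear_value K A M₀ D₁ D₂ D₃ D₄ D₅ D
  refine ⟨gauge D, fun ε hε hε1 => ?_⟩
  have hE1 : 1 ≤ ε⁻¹ := (one_le_inv₀ hε).2 hε1.le
  set M : ℕ := ⌈8 * d * C / ε⌉₊ with hMdef
  have hM : 8 * d * C ≤ M * ε := by
    have := Nat.le_ceil (8 * d * C / ε)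
    rwa [div_le_iff₀ hε] at this
  have hM1 : 1 ≤ M := Nat.one_le_iff_ne_zero.2 fun h => by
    rw [h] at hM
    have : 0 < 8 * d * C := by positivity
    simp at hM
    linarith
  have hMu : (M : ℝ) ≤ M₀ * ε⁻¹ := by
    have := (Nat.ceil_lt_add_one (by positivity : 0 ≤ 8 * d * C / ε)).le
    rw [hM₀, add_mul, one_mul, ← div_eq_mul_inv]
    linarith
  set c : ℝ := ε / (8 * 4 ^ (X * M + 1)) / (2 * d) with hc
  have hc0 : 0 < c := by positivity
  have hc1 : c ≤ 1 := by
    have h1 : (1 : ℝ) ≤ 4 ^ (X * M + 1) := Real.one_le_rpow (by norm_num) (by positivity)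
    rw [hc, div_div, div_le_one (by positivity)]
    nlinarith
  clear_value M c
  -- At least `c n` scales have variance at least `c` in some direction; fewer than half of that
  -- number are lost in the shift.
  refine ⟨c / 2, by positivity, ?_⟩
  intro m k n hm hk hn hmE hnk hmk hkm θ _ hcpt hdiam hent
  have hm1 : ∀ j, (1 : ℝ) ≤ m j := fun j => by exact_mod_cast hm j
  have hk1 : ∀ j, (1 : ℝ) ≤ k j := fun j => by exact_mod_cast hk j
  have hn0 : (0 : ℝ) < n := by exact_mod_cast hn
  have hmk' : ∀ j, m j ≤ k j := fun j => by
    exact_mod_cast (self_le_gauge hD1 (hm1 j)).trans (hmk j)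
  have hkm' : ∀ j j' : Fin d, (j' : ℕ) = j + 1 → k j' ≤ m j := fun j j' h => by
    exact_mod_cast (self_le_gauge hD1 (hk1 j')).trans (hkm j j' h)
  have hkanti : Antitone k := antitone_of_succ_le fun j j' h => (hkm' j j' h).trans (hmk' j)
  have hmanti : Antitone m := antitone_of_succ_le fun j j' h => (hmk' j').trans (hkm' j j' h)
  have hmE' : ∀ j, gauge D ε⁻¹ ≤ m j := fun j => hmE.trans
    (Nat.cast_le.2 (hmanti (show j.1 ≤ d - 1 by omega)))
  set k₀ : ℝ := ((k ⟨0, hd⟩ : ℕ) : ℝ) with hk₀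
  have hkk₀ : ∀ j, (k j : ℝ) ≤ k₀ := fun j => Nat.cast_le.2 (hkanti (Nat.zero_le j.1))
  have hk₀1 : 1 ≤ k₀ := hk1 _
  have hEk₀ : ε⁻¹ ≤ k₀ := ((self_le_gauge hD1 hE1).trans (hmE' ⟨0, hd⟩)).trans
    (Nat.cast_le.2 (hmk' _))
  set L : Fin d → ℕ := fun i => K * nextScale k i with hLdef
  have hLm : ∀ i, (L i : ℝ) ≤ K * m i := fun i => by
    have : (nextScale k i : ℝ) ≤ m i := Nat.cast_le.2 (nextScale_le hkm' i)
    simp only [hLdef, Nat.cast_mul]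
    gcongr
  have hLk₀ : ∀ i, (L i : ℝ) ≤ K * k₀ := fun i => (hLm i).trans (by
    have : (m i : ℝ) ≤ k₀ := (Nat.cast_le.2 (hmk' i)).trans (hkk₀ i)
    gcongr)
  have hθ : IsBoundedMeasure θ := by
    obtain ⟨R, hR⟩ := hcpt.isBounded.exists_norm_le
    exact ⟨R, by filter_upwards [Measure.support_mem_ae (μ := θ)] with x hx using hR x hx⟩
  have hMk₀ : (M : ℝ) ≤ M₀ * k₀ := hMu.trans (by gcongr)
  have hnR : d * (C + Real.log (1 + 4 ^ (X * (M + K * k₀)) * (ε⁻¹) ^ 2)) ≤ n * ε / 4 := by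
    have h1 := log_initial_entropy_le hε hε1 (by positivity : 0 ≤ X * (M + K * k₀))
    have h2 : X * (M + K * k₀) ≤ X * (M₀ + K) * k₀ := by
      rw [mul_assoc]
      refine mul_le_mul_of_nonneg_left ?_ hX0.le
      linarith
    have h3 : d * (C + Real.log (1 + 4 ^ (X * (M + K * k₀)) * (ε⁻¹) ^ 2)) ≤ D₃ / 4 * k₀ := by
      calc _ ≤ d * (C * k₀ + (1 * k₀ + 2 * (X * (M₀ + K) * k₀) + 2 * k₀)) := by
            refine mul_le_mul_of_nonneg_left ?_ (by positivity)
            have h5 : C * 1 ≤ C * k₀ := by gcongr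
            linarith
        _ = D₃ / 4 * k₀ := by rw [hD₃]; ring
    have h4 : D₃ * k₀ ≤ n * ε := by
      have h5 : D₃ * k₀ * ε⁻¹ ≤ n := by
        calc D₃ * k₀ * ε⁻¹ ≤ D * k₀ * k₀ := by
              have : D₃ ≤ D := by linarith
              gcongr
          _ = D * k₀ ^ 2 := by ring
          _ ≤ n := (le_gauge hD1 hk₀1).le.trans hnk
      calc D₃ * k₀ = D₃ * k₀ * ε⁻¹ * ε := by field_simp
        _ ≤ n * ε := by gcongr
    linarith
  obtain ⟨j, hj⟩ := exists_many_hasVariance hd hχ0 hX hcpt hε hdiam hn hent L hM1 hM hLk₀ hnR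
  rw [← hc] at hj
  refine ⟨j, ?_⟩
  obtain ⟨s, hs1, hs2, hs3, hs4⟩ := exists_scale_shift (hχ0 j) (hX j) hD1
    (show 2 * X * (A + 1) ≤ D by linarith) (hm j) (hk j) (hmk j)
  have hentm : Real.log 12 + W - Real.log c / 2 < ε * m j * Real.log 2 := by
    have h1 := Real.log_le_sub_one_of_pos (by norm_num : (0 : ℝ) < 12)
    have h2 := neg_log_variance_le hd hε (by positivity : 0 ≤ X * M)
    rw [← hc] at h2
    have h3 : X * M ≤ X * (M₀ * ε⁻¹) := by gcongr
    have h4 : Real.log 12 + W - Real.log c / 2 ≤ D₂ / 2 * ε⁻¹ := by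
      have e : D₂ / 2 * ε⁻¹ = 11 * ε⁻¹ + W * ε⁻¹ + (16 * d * ε⁻¹ + 2 * (X * (M₀ * ε⁻¹))
          + 2 * ε⁻¹ + ε⁻¹) := by rw [hD₂]; ring
      have h5 : W * 1 ≤ W * ε⁻¹ := by gcongr
      have h6 : 16 * (d : ℝ) * 1 ≤ 16 * d * ε⁻¹ := by gcongr
      have h7 : 0 ≤ 16 * d + 2 * (X * M + 1) + ε⁻¹ := by positivity
      linarith
    have h5 : D * (ε⁻¹) ^ 2 < m j := (le_gauge hD1 hE1).trans_le (hmE' j)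
    have h6 : D * ε⁻¹ < ε * m j := by
      have := mul_lt_mul_of_pos_left h5 hε
      have e : ε * (D * (ε⁻¹) ^ 2) = D * ε⁻¹ := by field_simp
      linarith
    have h7 : D₂ * ε⁻¹ ≤ D * ε⁻¹ := by
      have : D₂ ≤ D := by linarith
      gcongr
    have h8 : (1 / 2 : ℝ) ≤ Real.log 2 := by linarith [Real.log_two_gt_d9]
    have h9 : ε * m j * (1 / 2) ≤ ε * m j * Real.log 2 := by gcongr
    linarith
  have hLlow : ∀ i < j, (K : ℝ) * k j ≤ L i := fun i hi => by
    have : (k j : ℝ) ≤ nextScale k i := Nat.cast_le.2 (le_nextScale hkanti hi)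
    simp only [hLdef, Nat.cast_mul]
    gcongr
  have h2m : 2 * (m j : ℝ) ≤ k j := by
    refine le_trans ?_ ((mul_le_gauge hD1 (hm1 j)).trans (hmk j))
    have : 2 ≤ D := by linarith
    gcongr
  have hcount := ncard_shift_le
    (S := {q : ℕ | q < n ∧ HasVariance θ (offsetLevel χ L q) j c})
    (Q := {q : ℕ | 1 ≤ q ∧ q ≤ n ∧
      χ j - ε < 1 / (m j : ℝ) * tubeEntropy χ θ j (m j) (k j) q})
    (n := n) (L := L j) (s := s) (fun q hq => hq.1)
    ((Set.finite_le_nat n).subset fun q hq => hq.2.1)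
    (fun q hq a has ha1 han => ⟨ha1, han,
      lt_tubeEntropy_of_hasVariance hχ0 hX hx₀ hx₀χ hg hgap hK hA1 hA2 hθ has (hk j) (hm j)
        (hLm j) h2m hLlow hs1 hs2 hs3 hs4 hc0 hc1 hq.2 hentm⟩)
  have hcount' := hj.trans (Nat.cast_le.2 hcount)
  push_cast at hcount'
  -- The loss is linear in `k₀`, whereas `1 / c` is exponential in `1/ε`. Since `1/ε ≤ k₀`, the
  -- exponential factor of `gauge` at `k₀` covers it.
  have hsmall : (s : ℝ) + 1 + L j < n * c / 2 := by
    have h1 : (s : ℝ) ≤ 1 / x₀ * k₀ := by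
      have h2 : x₀ * s ≤ k₀ := le_trans (by have := hx₀χ j; gcongr) (hs4.trans (hkk₀ j))
      rw [one_div, inv_mul_eq_div, le_div_iff₀ hx₀]
      linarith
    have h2 : (s : ℝ) + 1 + L j ≤ (1 / x₀ + 1 + K) * k₀ := by
      have := hLk₀ j
      linarith
    have h3 : (1 / x₀ + 1 + K) * k₀ < (2 + 1 / x₀ + K) * k₀ := by
      exact mul_lt_mul_of_pos_right (by linarith) (by linarith)
    have h4 : (4 : ℝ) ^ (X * M + 1) ≤ 2 ^ (D * k₀) := by
      rw [show (4 : ℝ) = 2 ^ (2 : ℝ) by norm_num, ← Real.rpow_mul zero_le_two]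
      refine Real.rpow_le_rpow_of_exponent_le one_le_two ?_
      have h5 : X * M ≤ X * (M₀ * k₀) := by gcongr
      have h6 : D₅ * k₀ ≤ D * k₀ := by
        have : D₅ ≤ D := by linarith
        gcongr
      have e : D₅ * k₀ = 2 * (X * (M₀ * k₀)) + 5 * k₀ := by rw [hD₅]; ring
      linarith
    have h6 : D₄ * k₀ * ε⁻¹ * 4 ^ (X * M + 1) ≤ n := by
      calc _ ≤ D * k₀ * k₀ * 2 ^ (D * k₀) := by
            have : D₄ ≤ D := by linarith
            gcongr
        _ = gauge D k₀ := by rw [gauge]; ring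
        _ ≤ n := hnk
    have h7 : (2 + 1 / x₀ + K) * k₀ ≤ n * c / 2 := by
      have e : (2 + 1 / x₀ + K) * k₀ = D₄ * k₀ * ε⁻¹ * 4 ^ (X * M + 1) * c / 2 := by
        rw [hD₄, hc]; field_simp; ring
      rw [e]
      gcongr
    linarith
  rw [one_div, inv_mul_eq_div, lt_div_iff₀ hn0]
  linarith

end NonConformal

/-- The relation `R₁ ≪ R₂` is read as `f R₁ ≤ R₂`, for one function `f` that depends only on the
system; coordinates are indexed by `0, ..., d - 1`. -/
theorem proposition1p11 {Λ : Type*} [Fintype Λ] (d : ℕ) (hd : 1 ≤ d)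
    (r : Λ → Fin d → ℝ) (hr0 : ∀ i j, r i j ≠ 0) (hr1 : ∀ i j, |r i j| < 1)
    (p : Λ → ℝ) (hp0 : ∀ i, 0 ≤ p i) (hp1 : ∑ i, p i = 1)
    (hχ : StrictMono (lyapunovExponent p r)) :
    ∃ f : ℝ → ℝ, ∀ ε : ℝ, 0 < ε → ε < 1 → ∃ δ : ℝ, 0 < δ ∧
      ∀ (m k : Fin d → ℕ) (n : ℕ),
        (∀ j, 0 < m j) → (∀ j, 0 < k j) → 0 < n →
        f ε⁻¹ ≤ (m ⟨d - 1, by omega⟩ : ℝ) →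
        f (k ⟨0, by omega⟩ : ℝ) ≤ (n : ℝ) →
        (∀ j, f (m j : ℝ) ≤ (k j : ℝ)) →
        (∀ j j' : Fin d, (j' : ℕ) = (j : ℕ) + 1 → f (k j' : ℝ) ≤ (m j : ℝ)) →
        ∀ (θ : Measure (EuclideanSpace ℝ (Fin d))) [IsProbabilityMeasure θ],
          IsCompact θ.support →
          Metric.diam θ.support ≤ ε⁻¹ →
          ε < 1 / (n : ℝ) * entropy θ (partitionE (lyapunovExponent p r) (n : ℤ)) →
          ∃ j : Fin d,
            δ < 1 / (n : ℝ) *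
              (({q : ℕ | 1 ≤ q ∧ q ≤ n ∧
                lyapunovExponent p r j - ε <
                  1 / (m j : ℝ) * tubeEntropy (lyapunovExponent p r) θ j (m j) (k j) q}.ncard : ℕ) : ℝ) := by
  exact exists_many_full_tube_scales (by omega) (lyapunovExponent_pos hr0 hr1 hp0 hp1) hχ
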